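/- Let $(R,\mathfrak m)$ be a Cohen–Macaulay local ring with $\dim R=1$, let $I\subsetneq R$ be a canonical ideal of $R$ (an ideal that is a canonical module of $R$), and suppose that $I$ contains a parameter ideal $Q=(a)$ of $R$ as a reduction. In the total ring of fractions $\mathrm Q(R)$ put $K=\frac{I}{a}=\{\frac{x}{a}\mid x\in I\}$, $S=R[K]$, $\mathfrak c=R:S$ and $B=\mathfrak m:\mathfrak m=\{x\in \mathrm Q(R)\mid x\mathfrak m\subseteq\mathfrak m\}$. Let $\mathrm e(A)$ denote the multiplicity of a local ring $A$ with respect to its maximal ideal. A Cohen–Macaulay local ring $(A,\mathfrak m_A)$ of dimension one with canonical module $\mathrm K_A$ is called an almost Gorenstein local (AGL) ring if there is an exact sequence $0\to A\to \mathrm K_A\to C\to 0$ of $A$-modules with $\mathfrak m_A C=(0)$. The ring $R$ is called $2$-AGL if the Sally module $\mathcal S_Q(I)=I\cdot R[It]/I\cdot R[Qt]$ has rank $2$, that is, $\ell_{\mathcal T_{\mathfrak p}}(\mathcal S_Q(I)_{\mathfrak p})=2$ for $\mathcal T=R[Qt]$ and $\mathfrak p=\mathfrak m\mathcal T$. Suppose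 that the following conditions are satisfied. 1. $\mathrm e(R)=e\ge 3$ and $R$ is not an AGL ring. 2. $B$ is a local ring, with maximal ideal $\mathfrak n$ say, and it is an AGL ring with $\mathrm e(B)=e$. 3. There is an element $\alpha\in\mathfrak m$ such that $\mathfrak m^2=\alpha\mathfrak m$ and $\mathfrak n^2=\alpha\mathfrak n$. Then $R$ is a $2$-AGL ring and $K/R$ is a free $R/\mathfrak c$-module. -/

import Mathlib

universe u

open CategoryTheory Polynomial

noncomputable section

namespace TwoAGL

/-- A module `M` over a local ring `(A, 𝔪)` is maximal Cohen-Macaulay if it is finitely generated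
and there is an `M`-regular sequence in `𝔪` of length `dim A`. -/
structure IsMaximalCohenMacaulay (A : Type u) [CommRing A] [IsLocalRing A]
    (M : Type u) [AddCommGroup M] [Module A M] : Prop where
  finite : Module.Finite A M
  exists_regular : ∃ rs : List A, (∀ x ∈ rs, x ∈ IsLocalRing.maximalIdeal A) ∧
    RingTheory.Sequence.IsRegular M rs ∧ (rs.length : WithBot ℕ∞) = ringKrullDim A

/-- Cohen-Macaulay local rings (Noetherian by definition). -/
structure IsCohenMacaulayLocal (A : Type u) [CommRing A] [IsLocalRing A] : Prop where
  noetherian : IsNoetherianRing A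
  maximal : IsMaximalCohenMacaulay A A

/-- `ω` is a canonical module of the Cohen-Macaulay local ring `(A, 𝔪)`: a maximal Cohen-Macaulay
module of finite injective dimension and of type one, that is,
`ℓ_A (Ext_A^d (A/𝔪, ω)) = 1` for `d = dim A`. -/
structure IsCanonicalModule (A : Type u) [CommRing A] [IsLocalRing A]
    (ω : Type u) [AddCommGroup ω] [Module A ω] : Prop where
  maximal : IsMaximalCohenMacaulay A ω
  type_one : ∃ d : ℕ, ringKrullDim A = d ∧
    Module.length A (Abelian.Ext (ModuleCat.of A (IsLocalRing.ResidueField A))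
      (ModuleCat.of A ω) d) = 1
  finite_injectiveDimension : ∃ n : ℕ, HasInjectiveDimensionLT (ModuleCat.of A ω) n

/-- Almost Gorenstein local rings (of dimension one): Cohen-Macaulay local rings `(A, 𝔪)` with an
exact sequence `0 → A → K_A → C → 0` of `A`-modules such that `𝔪 C = 0`, where `K_A` is the
canonical module. -/
structure IsAGL (A : Type u) [CommRing A] [IsLocalRing A] : Prop where
  cohenMacaulay : IsCohenMacaulayLocal A
  exists_embedding : ∃ (ω : Type u) (_ : AddCommGroup ω) (_ : Module A ω),
    IsCanonicalModule A ω ∧ ∃ φ : A →ₗ[A] ω, Function.Injective φ ∧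
      ∀ r ∈ IsLocalRing.maximalIdeal A, ∀ c : ω ⧸ LinearMap.range φ, r • c = 0

/-- `e` is the multiplicity of the one-dimensional Noetherian local ring `(A, 𝔪)`: its
Hilbert-Samuel polynomial is `ℓ_A (A / 𝔪 ^ (n + 1)) = e (n + 1) - e₁` for all large `n`. -/
def HasMultiplicity (A : Type u) [CommRing A] [IsLocalRing A] (e : ℕ) : Prop :=
  ∃ e₁ : ℤ, ∀ᶠ n : ℕ in Filter.atTop, ∃ l : ℕ,
    Module.length A (A ⧸ IsLocalRing.maximalIdeal A ^ (n + 1)) = l ∧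
      (l : ℤ) = e * (n + 1) - e₁

/-- `J` is a reduction of the ideal `I`. -/
def IsReduction {R : Type u} [CommRing R] (J I : Ideal R) : Prop :=
  J ≤ I ∧ ∃ n : ℕ, I ^ (n + 1) = J * I ^ n

section Sally

variable {R : Type u} [CommRing R]

/-- The Rees algebra `R[Jt] ⊆ R[t]` of an ideal `J`, as a ring. -/
def Rees (J : Ideal R) : Type u := reesAlgebra J

instance (J : Ideal R) : CommRing (Rees J) := inferInstanceAs (CommRing (reesAlgebra J))

instance (J : Ideal R) : Algebra R (Rees J) := inferInstanceAs (Algebra R (reesAlgebra J))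

/-- The inclusion `R[Jt] ⊆ R[t]` makes `R[t]` an `R[Jt]`-algebra. -/
instance (J : Ideal R) : Algebra (Rees J) R[X] := (reesAlgebra J).val.toRingHom.toAlgebra

/-- For ideals `Q ⊆ J ⊆ I`: the extension `I · R[Jt]` of `I` to the Rees algebra `R[Jt] ⊆ R[t]`,
as a module over the Rees algebra `R[Qt]`. -/
def reesExtension (I Q J : Ideal R) : Submodule (Rees Q) R[X] :=
  Submodule.span (Rees Q) {g | ∃ x ∈ I, ∃ f ∈ reesAlgebra J, g = C x * f}

/-- The Sally module `I · R[It] / I · R[Qt]` of `I` with respect to `Q`, over `R[Qt]`. -/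
abbrev SallyModule (I Q : Ideal R) : Type u :=
  reesExtension I Q I ⧸ (reesExtension I Q Q).submoduleOf (reesExtension I Q I)

/-- The ideal `𝔭 = 𝔪 R[Qt]` of the Rees algebra `R[Qt]`. -/
def reesMax [IsLocalRing R] (Q : Ideal R) : Ideal (Rees Q) :=
  (IsLocalRing.maximalIdeal R).map (algebraMap R (Rees Q))

/-- The Sally module of `I` with respect to `Q` has rank `r`: the ideal `𝔭 = 𝔪 R[Qt]` is prime, and
the localization of the Sally module at `𝔭` has length `r` over `R[Qt]_𝔭`. -/
def HasSallyRank [IsLocalRing R] (I Q : Ideal R) (r : ℕ∞) : Prop :=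
  ∃ _ : (reesMax Q).IsPrime,
    Module.length (Localization.AtPrime (reesMax Q))
      (LocalizedModule (reesMax Q).primeCompl (SallyModule I Q)) = r

/-- The 2-AGL property, computed with the canonical ideal `I` and its parameter reduction `Q`. -/
def IsTwoAGL [IsLocalRing R] (I Q : Ideal R) : Prop :=
  HasSallyRank I Q 2

end Sally

section Fractions

variable {R : Type u} (Q : Type u) [CommRing R] [CommRing Q] [Algebra R Q]

/-- `K = I / a = {x / a | x ∈ I}` inside the total ring of fractions `Q` of `R`, for a
non-zerodivisor `a`. -/
def fracIdeal (I : Ideal R) (a : R) : Submodule R Q where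
  carrier := {y | ∃ x ∈ I, algebraMap R Q a * y = algebraMap R Q x}
  zero_mem' := ⟨0, I.zero_mem, by simp⟩
  add_mem' := by
    rintro y z ⟨x, hx, hy⟩ ⟨w, hw, hz⟩
    exact ⟨x + w, I.add_mem hx hw, by rw [mul_add, hy, hz, map_add]⟩
  smul_mem' := by
    rintro r y ⟨x, hx, hy⟩
    exact ⟨r * x, I.mul_mem_left r hx, by rw [mul_smul_comm, hy, Algebra.smul_def, map_mul]⟩

/-- The conductor `R : S = {r | r S ⊆ R}` of an `R`-subalgebra `S` of `Q`; it lies in `R` since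
`1 ∈ S`. -/
def conductor (S : Subalgebra R Q) : Ideal R where
  carrier := {r | ∀ s ∈ S, ∃ t : R, algebraMap R Q r * s = algebraMap R Q t}
  zero_mem' := fun s _ => ⟨0, by simp⟩
  add_mem' := by
    intro r r' h h' s hs
    obtain ⟨t, ht⟩ := h s hs
    obtain ⟨t', ht'⟩ := h' s hs
    exact ⟨t + t', by rw [map_add, add_mul, ht, ht', map_add]⟩
  smul_mem' := by
    intro c r h s hs
    obtain ⟨t, ht⟩ := h s hs
    exact ⟨c * t, by rw [smul_eq_mul, map_mul, mul_assoc, ht, map_mul]⟩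

variable (R)

/-- `B = 𝔪 : 𝔪 = {x ∈ Q | x 𝔪 ⊆ 𝔪}`, as an `R`-subalgebra of the total ring of fractions `Q`. -/
def maxColonMax [IsLocalRing R] : Subalgebra R Q where
  carrier := {x | ∀ r ∈ IsLocalRing.maximalIdeal R,
    ∃ s ∈ IsLocalRing.maximalIdeal R, x * algebraMap R Q r = algebraMap R Q s}
  mul_mem' := by
    intro x y hx hy r hr
    obtain ⟨s, hs, h⟩ := hy r hr
    obtain ⟨t, ht, h'⟩ := hx s hs
    exact ⟨t, ht, by rw [mul_assoc, h, h']⟩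
  add_mem' := by
    intro x y hx hy r hr
    obtain ⟨s, hs, h⟩ := hx r hr
    obtain ⟨t, ht, h'⟩ := hy r hr
    exact ⟨s + t, Ideal.add_mem _ hs ht, by rw [add_mul, h, h', map_add]⟩
  algebraMap_mem' := fun c r hr => ⟨c * r, Ideal.mul_mem_left _ c hr, by rw [map_mul]⟩

end Fractions

end TwoAGL

end

/-! Write B = 𝔪 : 𝔪 and A = 𝔫 : 𝔫, and let `β` be the image of α in the total ring of fractions. The
equations 𝔪² = α𝔪 and 𝔫² = α𝔫 say 𝔪 = βB and 𝔫 = βA. The heart of the proof is that R[K] = A; the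
rest is counting lengths.

The colon X ↦ K : X is a length-preserving duality on fractional ideals of R. As B is AGL, it has a
canonical fractional ideal L with B ⊆ L and 𝔫L ⊆ B, giving a similar duality on fractional ideals of
B. Uniqueness of canonical modules gives K : B = fL with f a unit (`exists_div_eq_unitSpan_mul`).
From 𝔫L ⊆ B and A ≠ B follow L ⊆ A and L : A = 𝔫, hence K : A = f𝔫 = fβA. On the other side K : KA =
(K : K) : A = R : A = β𝔫 = β²A. Dualizing once more, KA = hA for a unit h, and the reduction
equation Kᴺ⁺¹ = Kᴺ forces KA = A. So K ⊆ A and K : A = β𝔫 (`mul_le_and_div_eq_of_tower`).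

Equality of the multiplicities gives ℓ(B/𝔫) = 1 over R, so ℓ(𝔪/β𝔫) = 1 and ℓ(A/K) = ℓ(R/β𝔫) = 2. For
S = R[K] one has β𝔫 ⊆ R : S ⊆ 𝔪; equality on the right would make R AGL, so R : S = β𝔫, and S = A by
biduality. Thus ℓ(S/K) = ℓ(R/𝔠) = 2 (`exists_overring_structure`).

Rank: dividing degree i by aⁱ⁺¹ turns the Sally module into a submodule of (S/K)[X] over R[X] ≅
R[Qt] containing Xⁿ(S/K)[X]. Since X lies outside 𝔪R[X], localization there gives length ℓ(S/K) = 2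
(`hasSallyRank_two`).

Freeness: the tower gives ℓ(K/R) = 2(e - 2), while K/R needs e - 2 generators
(`relLength_of_tower`). It is killed by 𝔠, so (R/𝔠)ᵉ⁻² maps onto it, and the lengths agree
(`nonempty_equiv_of_relLength`). -/

namespace TwoAGL

/-! ### Relative lengths of submodules -/

section RelLength

variable {R M M' : Type*} [CommRing R] [AddCommGroup M] [Module R M] [AddCommGroup M'] [Module R M']

/-- The length of `Y / (X ∩ Y)` for submodules `X` and `Y` of a module. -/
noncomputable def relLength (X Y : Submodule R M) : ℕ∞ :=
  Module.length R (Y ⧸ X.submoduleOf Y)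

theorem relLength_eq_zero_iff {X Y : Submodule R M} : relLength X Y = 0 ↔ Y ≤ X := by
  rw [relLength, Module.length_eq_zero_iff, Submodule.Quotient.subsingleton_iff,
    Submodule.submoduleOf, Submodule.comap_subtype_eq_top]

@[simp]
theorem relLength_self (X : Submodule R M) : relLength X X = 0 :=
  relLength_eq_zero_iff.2 le_rfl

theorem relLength_top (X : Submodule R M) : relLength X ⊤ = Module.length R (M ⧸ X) := by
  refine (Submodule.Quotient.equiv _ X Submodule.topEquiv ?_).length_eq
  ext x
  simp [Submodule.submoduleOf]

theorem relLength_add {X Y Z : Submodule R M} (hXY : X ≤ Y) (hYZ : Y ≤ Z) :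
    relLength X Z = relLength X Y + relLength Y Z := by
  let f : (Y ⧸ X.submoduleOf Y) →ₗ[R] (Z ⧸ X.submoduleOf Z) :=
    Submodule.mapQ _ _ (Submodule.inclusion hYZ) (fun x hx => hx)
  let g : (Z ⧸ X.submoduleOf Z) →ₗ[R] (Z ⧸ Y.submoduleOf Z) :=
    Submodule.mapQ _ _ LinearMap.id (fun x hx => hXY hx)
  refine Module.length_eq_add_of_exact f g ?_ ?_ ?_
  · rw [← LinearMap.ker_eq_bot, LinearMap.ker_eq_bot']
    intro m hm
    obtain ⟨m, rfl⟩ := Submodule.Quotient.mk_surjective _ m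
    replace hm : (Submodule.Quotient.mk (Submodule.inclusion hYZ m) : Z ⧸ X.submoduleOf Z) = 0 := hm
    rw [Submodule.Quotient.mk_eq_zero] at hm
    rw [Submodule.Quotient.mk_eq_zero]
    exact hm
  · intro z
    obtain ⟨z, rfl⟩ := Submodule.Quotient.mk_surjective _ z
    exact ⟨Submodule.Quotient.mk z, rfl⟩
  · intro z
    obtain ⟨z, rfl⟩ := Submodule.Quotient.mk_surjective _ z
    change (Submodule.Quotient.mk z : Z ⧸ Y.submoduleOf Z) = 0 ↔ _
    rw [Submodule.Quotient.mk_eq_zero]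
    constructor
    · intro hz
      exact ⟨Submodule.Quotient.mk ⟨z, hz⟩, rfl⟩
    · rintro ⟨y, hy⟩
      obtain ⟨y, rfl⟩ := Submodule.Quotient.mk_surjective _ y
      replace hy : (Submodule.Quotient.mk (Submodule.inclusion hYZ y) : Z ⧸ X.submoduleOf Z) =
        Submodule.Quotient.mk z := hy
      rw [Submodule.Quotient.eq] at hy
      have h1 : (y : M) - z ∈ X := hy
      have h2 : (z : M) = y - (y - z) := by abel
      change (z : M) ∈ Y
      rw [h2]
      exact Y.sub_mem y.2 (hXY h1)

theorem relLength_sup (X Y : Submodule R M) : relLength X (X ⊔ Y) = relLength X Y := by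
  rw [sup_comm]
  refine LinearEquiv.length_eq ?_
  have := LinearMap.quotientInfEquivSupQuotient Y X
  refine ((Submodule.quotEquivOfEq _ _ ?_).trans this.symm).trans (Submodule.quotEquivOfEq _ _ ?_)
  · rfl
  · ext x
    simp [Submodule.submoduleOf]

theorem relLength_mono_right (X : Submodule R M) {Y Z : Submodule R M} (h : Y ≤ Z) :
    relLength X Y ≤ relLength X Z := by
  rw [← relLength_sup X Z, relLength_add (le_sup_left : X ≤ X ⊔ Y) (sup_le_sup_left h X),
    relLength_sup]
  exact le_self_add

theorem relLength_inf (X Y : Submodule R M) : relLength (X ⊓ Y) Y = relLength X Y := by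
  refine LinearEquiv.length_eq (Submodule.quotEquivOfEq _ _ ?_)
  ext x
  simp [Submodule.submoduleOf]

theorem relLength_map (f : M →ₗ[R] M') (hf : Function.Injective f) (X Y : Submodule R M) :
    relLength (X.map f) (Y.map f) = relLength X Y := by
  refine (LinearEquiv.length_eq (Submodule.Quotient.equiv _ _
    (Submodule.equivMapOfInjective f hf Y) ?_)).symm
  ext ⟨x, hx⟩
  obtain ⟨y, hy, rfl⟩ := hx
  simp only [Submodule.mem_map, Submodule.submoduleOf, Submodule.mem_comap, Submodule.subtype_apply]
  constructor
  · rintro ⟨z, hz, h⟩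
    exact ⟨z, hz, congrArg Subtype.val h⟩
  · rintro ⟨z, hz, h⟩
    obtain rfl := hf h
    exact ⟨⟨z, hy⟩, hz, rfl⟩

theorem eq_of_relLength_add_le {X Y Z : Submodule R M} (hXY : X ≤ Y) (hYZ : Y ≤ Z)
    (hfin : relLength X Y ≠ ⊤) (h : relLength X Z ≤ relLength X Y) : Y = Z := by
  rw [relLength_add hXY hYZ] at h
  refine le_antisymm hYZ (relLength_eq_zero_iff.1 ?_)
  generalize relLength X Y = p at *
  generalize relLength Y Z = q at *
  lift p to ℕ using hfin
  have hq : q ≠ ⊤ := by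
    rintro rfl
    simp at h
  lift q to ℕ using hq
  norm_cast at h ⊢
  omega

theorem relLength_le_one_of_forall_smul_mem [IsLocalRing R] {X Y : Submodule R M} {y : M}
    (hY : Y ≤ X ⊔ Submodule.span R {y}) (h : ∀ r ∈ IsLocalRing.maximalIdeal R, r • y ∈ X) :
    relLength X Y ≤ 1 := by
  refine (relLength_mono_right X hY).trans ?_
  rw [relLength_sup]
  have hs : IsSimpleModule R (R ⧸ IsLocalRing.maximalIdeal R) :=
    isSimpleModule_iff_isCoatom.2 (Ideal.isMaximal_def.1 inferInstance)
  rw [← Module.length_eq_one R (R ⧸ IsLocalRing.maximalIdeal R)]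
  let f : R →ₗ[R] (Submodule.span R {y}) := LinearMap.toSpanSingleton R _ ⟨y, Submodule.mem_span_singleton_self y⟩
  refine Module.length_le_of_surjective (Submodule.mapQ _ _ f ?_) ?_
  · intro r hr
    exact h r hr
  · intro z
    obtain ⟨⟨z, hz⟩, rfl⟩ := Submodule.Quotient.mk_surjective _ z
    obtain ⟨r, rfl⟩ := Submodule.mem_span_singleton.1 hz
    exact ⟨Submodule.Quotient.mk r, rfl⟩

theorem exists_smul_mem_of_relLength_ne_top [IsLocalRing R] {X Y : Submodule R M}
    (hfin : relLength X Y ≠ ⊤) (h : ¬ Y ≤ X) :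
    ∃ y ∈ Y, y ∉ X ∧ ∀ r ∈ IsLocalRing.maximalIdeal R, r • y ∈ X := by
  rw [relLength, Module.length_ne_top_iff, isFiniteLength_iff_isNoetherian_isArtinian] at hfin
  obtain ⟨_, _⟩ := hfin
  have : Nontrivial (Y ⧸ X.submoduleOf Y) := by
    rw [← Module.length_pos_iff (R := R)]
    exact pos_iff_ne_zero.2 fun h0 => h (relLength_eq_zero_iff.1 h0)
  obtain ⟨N, hN⟩ := IsAtomic.exists_atom (Submodule R (Y ⧸ X.submoduleOf Y))
  have hs : IsSimpleModule R N := isSimpleModule_iff_isAtom.2 hN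
  obtain ⟨w, hw, hw0⟩ := Submodule.exists_mem_ne_zero_of_ne_bot hN.1
  obtain ⟨⟨y, hy⟩, rfl⟩ := Submodule.Quotient.mk_surjective _ w
  refine ⟨y, hy, fun hyX => hw0 ((Submodule.Quotient.mk_eq_zero _).2 hyX), fun r hr => ?_⟩
  have hm := IsSimpleModule.annihilator_isMaximal (R := R) (M := N)
  have : r ∈ Module.annihilator R N := by
    rwa [IsLocalRing.eq_maximalIdeal hm]
  have h2 := congrArg Subtype.val (Module.mem_annihilator.1 this ⟨_, hw⟩)
  change r • Submodule.Quotient.mk _ = (0 : Y ⧸ X.submoduleOf Y) at h2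
  rw [← Submodule.Quotient.mk_smul, Submodule.Quotient.mk_eq_zero] at h2
  exact h2

theorem relLength_eq_one_of_forall_smul_mem [IsLocalRing R] {X Y : Submodule R M} {y : M}
    (hY : Y ≤ X ⊔ Submodule.span R {y}) (h : ∀ r ∈ IsLocalRing.maximalIdeal R, r • y ∈ X)
    (hne : ¬ Y ≤ X) : relLength X Y = 1 :=
  le_antisymm (relLength_le_one_of_forall_smul_mem hY h)
    (Order.one_le_iff_pos.2 (pos_iff_ne_zero.2 fun h0 => hne (relLength_eq_zero_iff.1 h0)))

end RelLength

/-! ### Length under restriction of scalars -/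

section ChangeOfRings

variable {R A M : Type*} [CommRing R] [CommRing A] [Algebra R A] [AddCommGroup M] [Module R M]
  [Module A M] [IsScalarTower R A M]

/-- A chain of `A`-submodules is a chain of `R`-submodules. The inequality can be strict when the
residue field grows, which the comparison of multiplicities later excludes. -/
theorem relLength_le_relLength_restrictScalars (X Y : Submodule A M) :
    relLength X Y ≤ relLength (X.restrictScalars R) (Y.restrictScalars R) := by
  have h1 := Submodule.length_le_length_restrictScalars R (⊤ : Submodule A (Y ⧸ X.submoduleOf Y))
  refine (Submodule.topEquiv.length_eq.symm.le.trans h1).trans_eq ?_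
  refine ((Submodule.restrictScalarsEquiv R A _ _).restrictScalars R ≪≫ₗ
    (Submodule.topEquiv (R := A) (M := Y ⧸ X.submoduleOf Y)).restrictScalars R).length_eq.trans ?_
  exact (Submodule.Quotient.restrictScalarsEquiv R (X.submoduleOf Y)).length_eq.symm

end ChangeOfRings

/-! ### Vanishing of Ext into modules of finite injective dimension -/

section ExtVanishing

open Abelian

variable {A : Type u} [CommRing A]

/-- The short complex `N → M → M ⧸ N`. -/
noncomputable abbrev quotientComplex {M : Type u} [AddCommGroup M] [Module A M]
    (N : Submodule A M) : ShortComplex (ModuleCat.{u} A) :=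
  ModuleCat.shortComplexOfCompEqZero N.subtype N.mkQ (by ext; simp)

theorem quotientComplex_shortExact {M : Type u} [AddCommGroup M] [Module A M]
    (N : Submodule A M) : (quotientComplex N).ShortExact :=
  ModuleCat.shortComplex_shortExact _
    (by
      intro x
      change N.mkQ x = 0 ↔ x ∈ Set.range N.subtype
      simp)
    N.injective_subtype N.mkQ_surjective

variable {S : ShortComplex (ModuleCat.{u} A)} (hS : S.ShortExact) {ω : ModuleCat.{u} A} {n : ℕ}

include hS

theorem subsingleton_ext_middle (h₁ : Subsingleton (Ext S.X₁ ω n))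
    (h₃ : Subsingleton (Ext S.X₃ ω n)) : Subsingleton (Ext S.X₂ ω n) := by
  refine subsingleton_of_forall_eq 0 fun y => ?_
  obtain ⟨z, rfl⟩ := Ext.contravariant_sequence_exact₂ hS ω y (Subsingleton.elim _ _)
  rw [Subsingleton.elim z 0, Ext.comp_zero]

theorem subsingleton_ext_left (h₂ : Subsingleton (Ext S.X₂ ω n))
    (h₃ : Subsingleton (Ext S.X₃ ω (n + 1))) : Subsingleton (Ext S.X₁ ω n) := by
  refine subsingleton_of_forall_eq 0 fun y => ?_
  obtain ⟨z, rfl⟩ := Ext.contravariant_sequence_exact₁ hS ω y (add_comm 1 n)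
    (Subsingleton.elim _ _)
  rw [Subsingleton.elim z 0, Ext.comp_zero]

theorem subsingleton_ext_right (h₁ : Subsingleton (Ext S.X₁ ω n))
    (h₂ : Subsingleton (Ext S.X₂ ω (n + 1))) : Subsingleton (Ext S.X₃ ω (n + 1)) := by
  refine subsingleton_of_forall_eq 0 fun y => ?_
  obtain ⟨z, rfl⟩ := Ext.contravariant_sequence_exact₃ hS ω y (Subsingleton.elim _ _)
    (add_comm 1 n)
  rw [Subsingleton.elim z 0, Ext.comp_zero]

omit hS

theorem subsingleton_ext_of_linearEquiv {M N : Type u} [AddCommGroup M] [Module A M]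
    [AddCommGroup N] [Module A N] (e : M ≃ₗ[A] N)
    (h : Subsingleton (Ext (ModuleCat.of A M) ω n)) :
    Subsingleton (Ext (ModuleCat.of A N) ω n) := by
  refine subsingleton_of_forall_eq 0 fun y => ?_
  have h1 : (Ext.mk₀ (e.toModuleIso.inv ≫ e.toModuleIso.hom)).comp y (zero_add n) = y := by
    rw [Iso.inv_hom_id, Ext.mk₀_id_comp]
  rw [← h1, ← Ext.mk₀_comp_mk₀_assoc, Subsingleton.elim ((Ext.mk₀ e.toModuleIso.hom).comp y _) 0,
    Ext.comp_zero]

theorem subsingleton_ext_self : Subsingleton (Ext (ModuleCat.of A A) ω (n + 1)) :=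
  Ext.subsingleton_of_projective _ _ _

/-- A cyclic module with regular relation has projective dimension at most one. -/
theorem subsingleton_ext_quotient_span_singleton {x : A} (hx : x ∈ nonZeroDivisors A) :
    Subsingleton (Ext (ModuleCat.of A (A ⧸ Ideal.span {x})) ω (n + 2)) := by
  refine subsingleton_ext_right (quotientComplex_shortExact (Ideal.span {x})) ?_
    subsingleton_ext_self
  refine subsingleton_ext_of_linearEquiv (M := A) ?_ subsingleton_ext_self
  refine (LinearEquiv.ofInjective (LinearMap.toSpanSingleton A A x) ?_).trans
    (LinearEquiv.ofEq _ _ (LinearMap.range_toSpanSingleton x))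
  intro r s hrs
  exact (mul_cancel_right_mem_nonZeroDivisors hx).1 hrs

variable [IsLocalRing A]

/-- The residue field as a quotient module. -/
def quotientEquivResidueField :
    (A ⧸ IsLocalRing.maximalIdeal A) ≃ₗ[A] IsLocalRing.ResidueField A :=
  LinearEquiv.refl A (A ⧸ IsLocalRing.maximalIdeal A)

theorem nonempty_equiv_residueField (M : Type u) [AddCommGroup M] [Module A M]
    [IsSimpleModule A M] : Nonempty (M ≃ₗ[A] IsLocalRing.ResidueField A) := by
  obtain ⟨I, hI, ⟨e⟩⟩ := (isSimpleModule_iff_quot_maximal (R := A) (M := M)).1 inferInstance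
  obtain rfl := IsLocalRing.eq_maximalIdeal hI
  exact ⟨e.trans quotientEquivResidueField⟩

theorem exists_submodule_equiv_residueField {M : Type u} [AddCommGroup M] [Module A M]
    [Nontrivial M] (hM : IsFiniteLength A M) :
    ∃ N : Submodule A M, Nonempty (N ≃ₗ[A] IsLocalRing.ResidueField A) := by
  obtain ⟨_, _⟩ := isFiniteLength_iff_isNoetherian_isArtinian.1 hM
  obtain ⟨N, hN⟩ := IsAtomic.exists_atom (Submodule A M)
  have hs : IsSimpleModule A N := isSimpleModule_iff_isAtom.2 hN
  exact ⟨N, nonempty_equiv_residueField N⟩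

theorem subsingleton_ext_of_isFiniteLength {i : ℕ}
    (h : Subsingleton (Ext (ModuleCat.of A (IsLocalRing.ResidueField A)) ω i))
    {M : Type u} [AddCommGroup M] [Module A M] (hM : IsFiniteLength A M) :
    Subsingleton (Ext (ModuleCat.of A M) ω i) := by
  induction hM with
  | @of_subsingleton M _ _ _ =>
    refine subsingleton_of_forall_eq 0 fun y => ?_
    have h0 : 𝟙 (ModuleCat.of A M) = 0 := by
      ext z
      exact @Subsingleton.elim M _ _ _
    rw [← Ext.mk₀_id_comp y, h0, Ext.mk₀_zero, Ext.zero_comp]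
  | @of_simple_quotient M _ _ N _ hN ih =>
    obtain ⟨e⟩ := nonempty_equiv_residueField (A := A) (M ⧸ N)
    exact subsingleton_ext_middle (quotientComplex_shortExact N) ih
      (subsingleton_ext_of_linearEquiv e.symm h)

/-- Over a local ring of depth one with a regular element `x` such that `A / x` has finite length,
a module of finite injective dimension has `Ext` from finite length modules only in degrees
at most one. -/
theorem subsingleton_ext_add_two {x : A} (hx : x ∈ nonZeroDivisors A)
    (hxm : x ∈ IsLocalRing.maximalIdeal A) (hxf : IsFiniteLength A (A ⧸ Ideal.span {x}))
    {m : ℕ} (hω : HasInjectiveDimensionLT ω m) (i : ℕ)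
    {M : Type u} [AddCommGroup M] [Module A M] (hM : IsFiniteLength A M) :
    Subsingleton (Ext (ModuleCat.of A M) ω (i + 2)) := by
  -- Descending induction on the degree: `j` bounds how far `i + 2` lies below the injective
  -- dimension bound `m`.
  suffices H : ∀ j i : ℕ, m ≤ i + 2 + j → ∀ (M : Type u) [AddCommGroup M] [Module A M],
      IsFiniteLength A M → Subsingleton (Ext (ModuleCat.of A M) ω (i + 2)) from
    H m i (by omega) M hM
  intro j
  induction j with
  | zero =>
    intro i hi M _ _ _
    exact HasInjectiveDimensionLT.subsingleton ω m _ hi _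
  | succ j ih =>
    intro i hi M _ _ hM
    refine subsingleton_ext_of_isFiniteLength ?_ hM
    have : Nontrivial (A ⧸ Ideal.span {x}) := by
      refine Ideal.Quotient.nontrivial_iff.2 fun h => ?_
      rw [Ideal.span_singleton_eq_top] at h
      exact hxm h
    -- The residue field embeds in `A / x`, so its Ext in degree `i + 2` is squeezed between that of
    -- `A / x`, of projective dimension at most one, and degree `i + 3` of a finite length quotient.
    obtain ⟨N, ⟨e⟩⟩ := exists_submodule_equiv_residueField hxf
    refine subsingleton_ext_of_linearEquiv e ?_
    exact subsingleton_ext_left (quotientComplex_shortExact N)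
      (subsingleton_ext_quotient_span_singleton hx)
      (ih (i + 1) (by omega) _ (hxf.of_surjective N.mkQ_surjective))

/-- Ext¹(J, ω) vanishes because Ext²(A/J, ω) does. If every map on (x) extended to J, then
Ext¹(J/(x), ω) would vanish too. The residue field embeds in J/(x) with finite length cokernel, so
its Ext¹ would also be zero. -/
theorem exists_not_extends {x : A} (hx : x ∈ nonZeroDivisors A)
    (hxm : x ∈ IsLocalRing.maximalIdeal A) (hxf : IsFiniteLength A (A ⧸ Ideal.span {x}))
    {m : ℕ} (hω : HasInjectiveDimensionLT ω m)
    (hk : Nontrivial (Ext (ModuleCat.of A (IsLocalRing.ResidueField A)) ω 1))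
    {J : Ideal A} (hJ : Ideal.span {x} < J) :
    ∃ φ : (Ideal.span {x}).submoduleOf J →ₗ[A] ω, ∀ ψ : J →ₗ[A] ω,
      ψ ∘ₗ ((Ideal.span {x}).submoduleOf J).subtype ≠ φ := by
  by_contra! hcon
  have hquot : IsFiniteLength A (A ⧸ J) :=
    hxf.of_surjective (f := Submodule.factor hJ.le) (Submodule.factor_surjective hJ.le)
  have hext : Subsingleton (Ext (ModuleCat.of A J) ω 1) :=
    subsingleton_ext_left (quotientComplex_shortExact J) subsingleton_ext_self
      (subsingleton_ext_add_two hx hxm hxf hω 0 hquot)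
  have hfin : IsFiniteLength A (J ⧸ (Ideal.span {x}).submoduleOf J) := by
    have h1 := relLength_mono_right (Ideal.span {x}) (le_top : J ≤ ⊤)
    rw [relLength_top] at h1
    exact Module.length_ne_top_iff.1 (ne_top_of_le_ne_top (Module.length_ne_top_iff.2 hxf) h1)
  set T := (Ideal.span {x}).submoduleOf J with hT
  have hE : Subsingleton (Ext (ModuleCat.of A (J ⧸ T)) ω 1) := by
    refine subsingleton_of_forall_eq 0 fun y => ?_
    obtain ⟨z, rfl⟩ := Ext.contravariant_sequence_exact₃ (quotientComplex_shortExact T) ω y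
      (@Subsingleton.elim _ hext _ _) (add_zero 1)
    obtain ⟨φ, rfl⟩ := (Ext.mk₀_bijective _ _).2 z
    obtain ⟨ψ, hψ⟩ := hcon φ.hom
    have h1 : φ = (quotientComplex T).f ≫ ModuleCat.ofHom ψ := by
      ext t
      exact (LinearMap.congr_fun hψ t).symm
    -- The connecting map kills every homomorphism that extends to `J`.
    rw [h1, ← Ext.mk₀_comp_mk₀, ShortComplex.ShortExact.extClass_comp_assoc]
  have : Nontrivial (J ⧸ T) := by
    rw [← Module.length_pos_iff (R := A)]
    refine pos_iff_ne_zero.2 fun h0 => hJ.not_ge (relLength_eq_zero_iff.1 h0)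
  obtain ⟨N, ⟨e⟩⟩ := exists_submodule_equiv_residueField hfin
  refine not_subsingleton_iff_nontrivial.2 hk (subsingleton_ext_of_linearEquiv e ?_)
  exact subsingleton_ext_left (quotientComplex_shortExact N) hE
    (subsingleton_ext_add_two hx hxm hxf hω 0 (hfin.of_surjective N.mkQ_surjective))

end ExtVanishing

/-! ### Colon submodules and multiplication by units -/

section Submodules

variable {R M M' : Type*} [CommRing R] [AddCommGroup M] [Module R M] [AddCommGroup M'] [Module R M']

theorem relLength_le_of_map {X Y : Submodule R M} {X' Y' : Submodule R M'} (f : M →ₗ[R] M')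
    (hY : ∀ y ∈ Y, f y ∈ Y') (hX : ∀ y ∈ Y, f y ∈ X' ↔ y ∈ X) :
    relLength X Y ≤ relLength X' Y' := by
  let g : Y →ₗ[R] Y' := f.restrict hY
  let h : (Y ⧸ X.submoduleOf Y) →ₗ[R] (Y' ⧸ X'.submoduleOf Y') :=
    Submodule.mapQ _ _ g (fun y hy => (hX y y.2).2 hy)
  refine Module.length_le_of_injective h ?_
  rw [← LinearMap.ker_eq_bot, LinearMap.ker_eq_bot']
  intro m hm
  obtain ⟨m, rfl⟩ := Submodule.Quotient.mk_surjective _ m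
  replace hm : (Submodule.Quotient.mk (g m) : Y' ⧸ X'.submoduleOf Y') = 0 := hm
  rw [Submodule.Quotient.mk_eq_zero] at hm ⊢
  exact (hX m m.2).1 hm

variable {Q : Type*} [CommRing Q] [Algebra R Q]

theorem div_mul_eq (X Y Z : Submodule R Q) : X / (Y * Z) = X / Y / Z := by
  refine eq_of_forall_le_iff fun W => ?_
  rw [Submodule.le_div_iff_mul_le, Submodule.le_div_iff_mul_le, Submodule.le_div_iff_mul_le,
    mul_assoc, mul_comm Z Y]

theorem div_antitone (L : Submodule R Q) {X Y : Submodule R Q} (h : X ≤ Y) : L / Y ≤ L / X :=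
  Submodule.le_div_iff_mul_le.2 ((mul_le_mul' le_rfl h).trans
    (Submodule.le_div_iff_mul_le.1 le_rfl))

theorem le_div_div (L X : Submodule R Q) : X ≤ L / (L / X) := by
  rw [Submodule.le_div_iff_mul_le, mul_comm]
  exact Submodule.le_div_iff_mul_le.1 le_rfl

variable (R) in
/-- The cyclic submodule generated by a unit. -/
def unitSpan (z : Qˣ) : Submodule R Q := Submodule.span R {(z : Q)}

theorem unitSpan_mul (z w : Qˣ) : unitSpan R z * unitSpan R w = unitSpan R (z * w) := by
  simp [unitSpan, Submodule.span_mul_span]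

theorem unitSpan_one : unitSpan R (1 : Qˣ) = 1 := by
  simp [unitSpan, Submodule.one_eq_span]

theorem unitSpan_inv_mul_cancel (z : Qˣ) (X : Submodule R Q) :
    unitSpan R z⁻¹ * (unitSpan R z * X) = X := by
  rw [← mul_assoc, unitSpan_mul, inv_mul_cancel, unitSpan_one, one_mul]

theorem unitSpan_mul_inv_cancel (z : Qˣ) (X : Submodule R Q) :
    unitSpan R z * (unitSpan R z⁻¹ * X) = X := by
  rw [← mul_assoc, unitSpan_mul, mul_inv_cancel, unitSpan_one, one_mul]

theorem mem_unitSpan_mul {z : Qˣ} {X : Submodule R Q} {y : Q} :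
    y ∈ unitSpan R z * X ↔ ↑z⁻¹ * y ∈ X := by
  rw [unitSpan, Submodule.mem_span_singleton_mul]
  constructor
  · rintro ⟨w, hw, rfl⟩
    simpa using hw
  · intro h
    exact ⟨_, h, by simp⟩

theorem unitSpan_mul_le_iff {z : Qˣ} {X Y : Submodule R Q} :
    unitSpan R z * X ≤ Y ↔ X ≤ unitSpan R z⁻¹ * Y := by
  constructor
  · intro h
    rw [← unitSpan_inv_mul_cancel z X]
    exact mul_le_mul' le_rfl h
  · intro h
    rw [← unitSpan_mul_inv_cancel z Y]
    exact mul_le_mul' le_rfl h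

theorem div_unitSpan (X : Submodule R Q) (z : Qˣ) : X / unitSpan R z = unitSpan R z⁻¹ * X := by
  refine eq_of_forall_le_iff fun W => ?_
  rw [Submodule.le_div_iff_mul_le, mul_comm, unitSpan_mul_le_iff]

theorem unitSpan_mul_div (X Y : Submodule R Q) (z : Qˣ) :
    (unitSpan R z * X) / Y = unitSpan R z * (X / Y) := by
  refine eq_of_forall_le_iff fun W => ?_
  have h : W * Y ≤ unitSpan R z * X ↔ unitSpan R z⁻¹ * (W * Y) ≤ X := by
    rw [unitSpan_mul_le_iff, inv_inv]
  rw [Submodule.le_div_iff_mul_le, h, ← mul_assoc, ← Submodule.le_div_iff_mul_le,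
    unitSpan_mul_le_iff, inv_inv]

theorem div_unitSpan_mul (X Y : Submodule R Q) (z : Qˣ) :
    X / (unitSpan R z * Y) = unitSpan R z⁻¹ * (X / Y) := by
  rw [div_mul_eq, div_unitSpan, unitSpan_mul_div]

theorem relLength_unitSpan_mul (z : Qˣ) (X Y : Submodule R Q) :
    relLength (unitSpan R z * X) (unitSpan R z * Y) = relLength X Y := by
  have key : ∀ (z : Qˣ) (X Y : Submodule R Q),
      relLength X Y ≤ relLength (unitSpan R z * X) (unitSpan R z * Y) := by
    intro z X Y
    refine relLength_le_of_map (LinearMap.mulLeft R (z : Q)) ?_ ?_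
    · intro y hy
      rw [mem_unitSpan_mul]
      simpa using hy
    · intro y hy
      rw [mem_unitSpan_mul]
      simp
  refine le_antisymm ((key z⁻¹ _ _).trans_eq ?_) (key z X Y)
  rw [unitSpan_inv_mul_cancel, unitSpan_inv_mul_cancel]

end Submodules

/-! ### The two basic properties of a canonical fractional ideal -/

section Canonical

open Abelian

variable {A Q : Type u} [CommRing A] [IsLocalRing A] [CommRing Q] [Algebra A Q]

variable (A Q) in
/-- The maximal ideal of a local ring `A`, as a submodule of an `A`-algebra. -/
def maxSubmodule : Submodule A Q :=
  Submodule.map (Algebra.linearMap A Q) (IsLocalRing.maximalIdeal A)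

theorem algebraMap_mem_maxSubmodule {r : A} (hr : r ∈ IsLocalRing.maximalIdeal A) :
    algebraMap A Q r ∈ maxSubmodule A Q :=
  Submodule.mem_map_of_mem (f := Algebra.linearMap A Q) hr

variable {ω : Type u} [AddCommGroup ω] [Module A ω] {L : Submodule A Q}

/-- A multiplier t of L outside A makes J = x(L : L) ∩ A strictly larger than (x). Every map (x) → L
then extends to J, since r/x acts on L for r in J; this contradicts `exists_not_extends`. -/
theorem div_self_eq_one_of_canonical {x : A} (hx : x ∈ nonZeroDivisors A)
    (hxm : x ∈ IsLocalRing.maximalIdeal A) (hxf : IsFiniteLength A (A ⧸ Ideal.span {x}))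
    (hxu : IsUnit (algebraMap A Q x)) (h1 : 1 ≤ L)
    (hL : ∀ y ∈ L, x • y ∈ (1 : Submodule A Q)) (e : L ≃ₗ[A] ω)
    {m : ℕ} (hω : HasInjectiveDimensionLT (ModuleCat.of A ω) m)
    (hk : Nontrivial (Ext (ModuleCat.of A (IsLocalRing.ResidueField A)) (ModuleCat.of A ω) 1)) :
    L / L = 1 := by
  obtain ⟨z, hz⟩ := hxu
  have h1L : (1 : Q) ∈ L := Submodule.one_le.1 h1
  have hTL : L / L ≤ L := fun t ht => by
    simpa using Submodule.mem_div_iff_forall_mul_mem.1 ht 1 h1L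
  have h1T : (1 : Q) ∈ L / L := Submodule.one_mem_div.2 le_rfl
  by_contra hne
  obtain ⟨t, ht, ht1⟩ : ∃ t ∈ L / L, t ∉ (1 : Submodule A Q) := by
    by_contra! hcon
    exact hne (le_antisymm hcon (Submodule.one_le.2 h1T))
  let J : Ideal A := (L / L).comap (LinearMap.mulLeft A (↑z⁻¹ : Q) ∘ₗ Algebra.linearMap A Q)
  have memJ : ∀ r : A, r ∈ J ↔ ↑z⁻¹ * algebraMap A Q r ∈ L / L := fun r => Iff.rfl
  have hxJ : x ∈ J := by
    rw [memJ, ← hz, Units.inv_mul]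
    exact h1T
  have hJ : Ideal.span {x} < J := by
    refine lt_of_le_not_ge ((Ideal.span_singleton_le_iff_mem _).2 hxJ) fun hle => ht1 ?_
    obtain ⟨r, hr⟩ := Submodule.mem_one.1 (hL t (hTL ht))
    have hrJ : r ∈ J := by
      rw [memJ, hr, Algebra.smul_def, ← hz, Units.inv_mul_cancel_left]
      exact ht
    obtain ⟨s, rfl⟩ := Ideal.mem_span_singleton'.1 (hle hrJ)
    rw [map_mul, Algebra.smul_def, mul_comm, ← hz] at hr
    exact Submodule.mem_one.2 ⟨s, (Units.mul_right_inj z).1 hr⟩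
  obtain ⟨φ, hφ⟩ := exists_not_extends hx hxm hxf hω hk hJ
  let x' : (Ideal.span {x}).submoduleOf J := ⟨⟨x, hxJ⟩, Ideal.mem_span_singleton_self x⟩
  let l : L := e.symm (φ x')
  -- The extension r ↦ (r/x)l, where l is the value of the given map at x.
  let ψ₀ : J →ₗ[A] L :=
    (LinearMap.mulRight A (l : Q) ∘ₗ LinearMap.mulLeft A (↑z⁻¹ : Q) ∘ₗ
      Algebra.linearMap A Q ∘ₗ J.subtype).codRestrict L
      (fun r => Submodule.mem_div_iff_forall_mul_mem.1 ((memJ r).1 r.2) l l.2)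
  refine hφ (e.toLinearMap ∘ₗ ψ₀) ?_
  ext ⟨⟨w, hwJ⟩, hw⟩
  obtain ⟨s, rfl⟩ := Ideal.mem_span_singleton'.1 hw
  have h2 : (⟨⟨s * x, hwJ⟩, hw⟩ : (Ideal.span {x}).submoduleOf J) = s • x' := rfl
  rw [h2, map_smul]
  have h4 : ψ₀ ⟨x, hxJ⟩ = l := by
    ext
    change ↑z⁻¹ * algebraMap A Q x * (l : Q) = (l : Q)
    rw [← hz, Units.inv_mul, one_mul]
  rw [map_smul]
  change s • e (ψ₀ ⟨x, hxJ⟩) = _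
  rw [h4]
  simp [l]

/-- An element of L : 𝔪 is a map 𝔪 → L, whose image in Ext¹(k, ω) vanishes only if it extends to A,
that is, only if the element lies in L. So (L : 𝔪)/L is a subquotient of a module of length one. -/
theorem relLength_div_maxSubmodule_le_one {x : A}
    (hxm : x ∈ IsLocalRing.maximalIdeal A) (hxu : IsUnit (algebraMap A Q x)) (e : L ≃ₗ[A] ω)
    (hk : Module.length A (Ext (ModuleCat.of A (IsLocalRing.ResidueField A))
      (ModuleCat.of A ω) 1) = 1) :
    relLength L (L / maxSubmodule A Q) ≤ 1 := by
  obtain ⟨z, hz⟩ := hxu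
  let μ : ↥(L / maxSubmodule A Q) →ₗ[A] (IsLocalRing.maximalIdeal A →ₗ[A] ω) :=
    { toFun := fun f => e.toLinearMap ∘ₗ
        (LinearMap.mulLeft A (f : Q) ∘ₗ Algebra.linearMap A Q ∘ₗ
          (IsLocalRing.maximalIdeal A).subtype).codRestrict L
          (fun r => Submodule.mem_div_iff_forall_mul_mem.1 f.2 _
            (algebraMap_mem_maxSubmodule r.2))
      map_add' := fun f g => by
        ext r
        simp only [LinearMap.comp_apply, LinearMap.add_apply, LinearEquiv.coe_coe]
        rw [← map_add]
        congr 1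
        ext
        exact add_mul _ _ _
      map_smul' := fun s f => by
        ext r
        simp only [LinearMap.comp_apply, LinearMap.smul_apply, LinearEquiv.coe_coe,
          RingHom.id_apply]
        rw [← map_smul]
        congr 1
        ext
        exact smul_mul_assoc _ _ _ }
  have hS := quotientComplex_shortExact (IsLocalRing.maximalIdeal A)
  -- The connecting homomorphism of 0 → 𝔪 → A → k → 0.
  let δ : (IsLocalRing.maximalIdeal A →ₗ[A] ω) →ₗ[A]
      Ext (ModuleCat.of A (IsLocalRing.ResidueField A)) (ModuleCat.of A ω) 1 :=
    { toFun := fun φ => hS.extClass.comp (Ext.mk₀ (ModuleCat.ofHom φ)) (add_zero 1)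
      map_add' := fun φ ψ => by
        rw [ModuleCat.ofHom_add, Ext.mk₀_add, Ext.comp_add]
        rfl
      map_smul' := fun r φ => by
        have h : ModuleCat.ofHom (r • φ) = r • ModuleCat.ofHom φ := rfl
        rw [h, Ext.mk₀_smul, Ext.comp_smul]
        rfl }
  have hker : LinearMap.ker (δ ∘ₗ μ) ≤ L.submoduleOf (L / maxSubmodule A Q) := by
    intro f hf
    obtain ⟨y, hy⟩ := Ext.contravariant_sequence_exact₁ hS (ModuleCat.of A ω)
      (Ext.mk₀ (ModuleCat.ofHom (μ f))) (add_zero 1) hf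
    obtain ⟨ψ, rfl⟩ := (Ext.mk₀_bijective _ _).2 y
    rw [Ext.mk₀_comp_mk₀] at hy
    have h1 := (Ext.mk₀_bijective _ _).1 hy
    have h2 : ψ.hom x = μ f ⟨x, hxm⟩ :=
      LinearMap.congr_fun (congrArg ModuleCat.Hom.hom h1) ⟨x, hxm⟩
    have h3 : x • e.symm (ψ.hom (1 : A)) = e.symm (ψ.hom x) := by
      rw [← map_smul, ← map_smul, smul_eq_mul, mul_one]
    have h4 : algebraMap A Q x * (e.symm (ψ.hom (1 : A)) : L) = (f : Q) * algebraMap A Q x := by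
      have := congrArg Subtype.val h3
      rw [h2] at this
      rw [← Algebra.smul_def]
      refine this.trans ?_
      change ((e.symm (e _) : L) : Q) = _
      rw [e.symm_apply_apply]
      rfl
    change (f : Q) ∈ L
    rw [← hz, mul_comm, Units.mul_left_inj] at h4
    rw [← h4]
    exact (e.symm (ψ.hom (1 : A))).2
  calc relLength L (L / maxSubmodule A Q)
      ≤ Module.length A (↥(L / maxSubmodule A Q) ⧸ LinearMap.ker (δ ∘ₗ μ)) :=
        Module.length_le_of_surjective (Submodule.factor hker) (Submodule.factor_surjective hker)
    _ ≤ _ := by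
        rw [(LinearMap.quotKerEquivRange (δ ∘ₗ μ)).length_eq]
        exact Module.length_le_of_injective _ (Submodule.injective_subtype _)
    _ = 1 := hk

end Canonical

/-! ### Duality with respect to a canonical fractional ideal -/

section Duality

variable {A Q : Type u} [CommRing A] [IsLocalRing A] [CommRing Q] [Algebra A Q]
  {L : Submodule A Q}

/-- Climb from X to Y by simple steps X' = X + Ay with 𝔪y ⊆ X. Multiplication by y embeds (L : X)/(L
: X') into (L : 𝔪)/L, so each step costs at most one. -/
theorem relLength_div_le (hm : relLength L (L / maxSubmodule A Q) ≤ 1)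
    {X Y : Submodule A Q} (hXY : X ≤ Y) : relLength (L / Y) (L / X) ≤ relLength X Y := by
  rcases eq_or_ne (relLength X Y) ⊤ with htop | hfin
  · rw [htop]
    exact le_top
  obtain ⟨n, hn⟩ := ENat.ne_top_iff_exists.1 hfin
  induction n generalizing X with
  | zero =>
    have : X = Y := le_antisymm hXY (relLength_eq_zero_iff.1 hn.symm)
    rw [this]
    simp
  | succ n ih =>
    have hle : ¬ Y ≤ X := fun h => by
      rw [relLength_eq_zero_iff.2 h] at hn
      norm_cast at hn
    obtain ⟨y, hyY, hyX, hy⟩ := exists_smul_mem_of_relLength_ne_top hfin hle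
    set X' := X ⊔ Submodule.span A {y} with hX'
    have hXX' : X ≤ X' := le_sup_left
    have hX'Y : X' ≤ Y := sup_le hXY (by simpa using hyY)
    have hyX' : y ∈ X' := Submodule.mem_sup_right (Submodule.mem_span_singleton_self y)
    have hone : relLength X X' = 1 :=
      relLength_eq_one_of_forall_smul_mem le_rfl hy fun h => hyX (h hyX')
    have hadd := relLength_add hXX' hX'Y
    have hfin' : relLength X' Y ≠ ⊤ := by
      intro h
      rw [h] at hadd
      exact hfin (by rw [hadd]; simp)
    have hn' : (n : ℕ∞) = relLength X' Y := by
      rw [hone, ← hn] at hadd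
      generalize relLength X' Y = q at *
      lift q to ℕ using hfin'
      norm_cast at hadd ⊢
      omega
    have h1 := ih hX'Y hfin' hn'
    have h2 : relLength (L / X') (L / X) ≤ 1 := by
      refine le_trans (relLength_le_of_map (LinearMap.mulRight A y) ?_ ?_) hm
      · intro f hf
        rw [Submodule.mem_div_iff_forall_mul_mem]
        rintro _ ⟨r, hr, rfl⟩
        rw [LinearMap.mulRight_apply, Algebra.linearMap_apply, mul_assoc, mul_comm y,
          ← Algebra.smul_def]
        exact Submodule.mem_div_iff_forall_mul_mem.1 hf _ (hy r hr)
      · intro f hf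
        rw [LinearMap.mulRight_apply]
        constructor
        · intro hfy
          rw [Submodule.mem_div_iff_forall_mul_mem]
          intro w hw
          obtain ⟨x, hx, v, hv, rfl⟩ := Submodule.mem_sup.1 hw
          obtain ⟨s, rfl⟩ := Submodule.mem_span_singleton.1 hv
          rw [mul_add, mul_smul_comm]
          exact L.add_mem (Submodule.mem_div_iff_forall_mul_mem.1 hf x hx) (L.smul_mem s hfy)
        · intro hf'
          exact Submodule.mem_div_iff_forall_mul_mem.1 hf' y hyX'
    rw [relLength_add (div_antitone L hX'Y) (div_antitone L hXX'), hadd, hone, add_comm]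
    exact add_le_add h2 h1

/-- Since L : L = A, the cyclic module zA is its own bidual. Dualizing twice does not increase
length over zA, so the bidual of X, which contains X, cannot be larger. -/
theorem div_div_eq_of_relLength_ne_top (hL : L / L = 1)
    (hm : relLength L (L / maxSubmodule A Q) ≤ 1) {X : Submodule A Q} {z : Qˣ}
    (hz : (z : Q) ∈ X) (hX : relLength (unitSpan A z) X ≠ ⊤) : L / (L / X) = X := by
  have hzX : unitSpan A z ≤ X := by
    rw [unitSpan]
    simpa using hz
  have h1 : L / (L / unitSpan A z) = unitSpan A z := by
    rw [div_unitSpan, div_unitSpan_mul, hL, inv_inv, mul_one]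
  have h2 : relLength (unitSpan A z) (L / (L / X)) ≤ relLength (unitSpan A z) X := by
    have := (relLength_div_le hm (div_antitone L hzX)).trans (relLength_div_le hm hzX)
    rwa [h1] at this
  exact (eq_of_relLength_add_le hzX (le_div_div L X) hX h2).symm

theorem relLength_div_eq (hm : relLength L (L / maxSubmodule A Q) ≤ 1)
    {X Y : Submodule A Q} (hXY : X ≤ Y) (hX : L / (L / X) = X) (hY : L / (L / Y) = Y) :
    relLength (L / Y) (L / X) = relLength X Y := by
  refine le_antisymm (relLength_div_le hm hXY) ?_
  have := relLength_div_le hm (div_antitone L hXY)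
  rwa [hX, hY] at this

end Duality

/-! ### Fractional ideals commensurable with a power of `z` -/

section Commensurable

variable {A Q : Type u} [CommRing A] [CommRing Q] [Algebra A Q]

/-- The submodule `X` contains a power of `z` and is mapped into `A` by a power of `z`. -/
def Commensurable (z : Q) (X : Submodule A Q) : Prop :=
  (∃ i : ℕ, z ^ i ∈ X) ∧ ∃ j : ℕ, ∀ y ∈ X, z ^ j * y ∈ (1 : Submodule A Q)

theorem Commensurable.mul {z : Q} {X Y : Submodule A Q} (hX : Commensurable z X)
    (hY : Commensurable z Y) : Commensurable z (X * Y) := by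
  obtain ⟨⟨i, hi⟩, ⟨j, hj⟩⟩ := hX
  obtain ⟨⟨k, hk⟩, ⟨l, hl⟩⟩ := hY
  refine ⟨⟨i + k, by rw [pow_add]; exact Submodule.mul_mem_mul hi hk⟩, ⟨j + l, fun y hy => ?_⟩⟩
  induction hy using Submodule.mul_induction_on' with
  | mem_mul_mem m hm n hn =>
    rw [pow_add, mul_mul_mul_comm, ← one_mul (1 : Submodule A Q)]
    exact Submodule.mul_mem_mul (hj m hm) (hl n hn)
  | add x hx y hy h1 h2 =>
    rw [mul_add]
    exact Submodule.add_mem _ h1 h2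

theorem Commensurable.div {z : Q} {X Y : Submodule A Q} (hX : Commensurable z X)
    (hY : Commensurable z Y) : Commensurable z (X / Y) := by
  obtain ⟨⟨i, hi⟩, ⟨j, hj⟩⟩ := hX
  obtain ⟨⟨k, hk⟩, ⟨l, hl⟩⟩ := hY
  refine ⟨⟨i + l, ?_⟩, ⟨j + k, fun y hy => ?_⟩⟩
  · rw [Submodule.mem_div_iff_forall_mul_mem]
    intro y hy
    obtain ⟨r, hr⟩ := Submodule.mem_one.1 (hl y hy)
    rw [pow_add, mul_assoc, ← hr, mul_comm, ← Algebra.smul_def]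
    exact X.smul_mem r hi
  · rw [pow_add, mul_assoc, mul_comm _ y]
    exact hj _ (Submodule.mem_div_iff_forall_mul_mem.1 hy _ hk)

theorem isFiniteLength_quotient_of_pow_le [IsLocalRing A] [IsNoetherianRing A] {J : Ideal A}
    {k : ℕ} (h : IsLocalRing.maximalIdeal A ^ k ≤ J) : IsFiniteLength A (A ⧸ J) := by
  rcases eq_or_ne J ⊤ with rfl | hJ
  · have : Subsingleton (A ⧸ (⊤ : Ideal A)) := Ideal.Quotient.subsingleton_iff.2 rfl
    exact .of_subsingleton
  have hnt : Nontrivial (A ⧸ J) := Ideal.Quotient.nontrivial_iff.2 hJ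
  have hloc : IsLocalRing (A ⧸ J) :=
    IsLocalRing.of_surjective' (Ideal.Quotient.mk J) Ideal.Quotient.mk_surjective
  have hart : IsArtinianRing (A ⧸ J) := by
    rw [isArtinianRing_iff_isNilpotent_maximalIdeal]
    refine ⟨k, ?_⟩
    have h1 : IsLocalRing.maximalIdeal (A ⧸ J) =
        (IsLocalRing.maximalIdeal A).map (Ideal.Quotient.mk J) := by
      refine (IsLocalRing.eq_maximalIdeal ?_).symm
      exact Ideal.IsMaximal.map_of_surjective_of_ker_le Ideal.Quotient.mk_surjective
        (by rw [Ideal.mk_ker]; exact IsLocalRing.le_maximalIdeal hJ)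
    rw [h1, ← Ideal.map_pow, Ideal.zero_eq_bot, Ideal.map_eq_bot_iff_le_ker, Ideal.mk_ker]
    exact h
  rw [← Module.length_ne_top_iff, Module.length_eq_of_surjective (S := A) (R := A ⧸ J)
    Ideal.Quotient.mk_surjective]
  exact Module.length_ne_top

end Commensurable

/-! ### Multiplicity when 𝔪² = x𝔪 -/

section Multiplicity

variable {A : Type u} [CommRing A]

theorem map_mulLeft_eq_span_singleton_mul (x : A) (X : Ideal A) :
    Submodule.map (LinearMap.mulLeft A x) X = Ideal.span {x} * X := by
  ext y
  simp [Ideal.mem_span_singleton_mul]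

theorem relLength_span_singleton_mul {x : A} (hx : x ∈ nonZeroDivisors A) (X Y : Ideal A) :
    relLength (Ideal.span {x} * X) (Ideal.span {x} * Y) = relLength X Y := by
  rw [← map_mulLeft_eq_span_singleton_mul, ← map_mulLeft_eq_span_singleton_mul]
  exact relLength_map _ (fun r s h => (mul_cancel_left_mem_nonZeroDivisors hx).1 h) X Y

/-- Multiplication by x identifies consecutive quotients 𝔪ⁿ/𝔪ⁿ⁺¹ for n ≥ 1, so their common length
is the first difference of the Hilbert–Samuel polynomial, which is e. -/
theorem relLength_eq_of_hasMultiplicity [IsLocalRing A] {x : A} (hx : x ∈ nonZeroDivisors A)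
    (h : IsLocalRing.maximalIdeal A ^ 2 = Ideal.span {x} * IsLocalRing.maximalIdeal A)
    {e : ℕ} (he : HasMultiplicity A e) :
    relLength (Ideal.span {x} * IsLocalRing.maximalIdeal A) (IsLocalRing.maximalIdeal A) = e := by
  set m := IsLocalRing.maximalIdeal A
  have key : ∀ n : ℕ, relLength (m ^ (n + 2)) (m ^ (n + 1)) = relLength (m ^ 2) m := by
    intro n
    induction n with
    | zero => simp
    | succ n ih =>
      have h1 : ∀ k : ℕ, m ^ (k + 2) = Ideal.span {x} * m ^ (k + 1) := fun k => by
        rw [add_comm, pow_add, h, pow_succ', mul_assoc]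
      exact (by rw [h1 (n + 1), show n + 1 + 1 = n + 2 from rfl] :
        relLength (m ^ (n + 3)) (m ^ (n + 2)) =
          relLength (Ideal.span {x} * m ^ (n + 2)) (m ^ (n + 2))).trans
        ((congrArg _ (h1 n)).trans ((relLength_span_singleton_mul hx _ _).trans ih))
  obtain ⟨c, hc⟩ := he
  obtain ⟨N, hN⟩ := Filter.eventually_atTop.1 hc
  obtain ⟨l, hl, hl'⟩ := hN N le_rfl
  obtain ⟨l', hl₁, hl₁'⟩ := hN (N + 1) (by omega)
  have h2 := relLength_add (Ideal.pow_le_pow_right (I := m) (by omega : N + 1 ≤ N + 2))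
    (le_top : m ^ (N + 1) ≤ ⊤)
  rw [key, relLength_top, relLength_top, hl, hl₁, h] at h2
  have h3 : (l' : ℤ) = l + e := by
    rw [hl', hl₁']
    push_cast
    ring
  have h4 : l' = e + l := by omega
  generalize relLength (Ideal.span {x} * m) m = q at *
  have hq : q ≠ ⊤ := by
    rintro rfl
    simp at h2
  lift q to ℕ using hq
  norm_cast at h2 ⊢
  omega

end Multiplicity

/-! ### The ring 𝔪 : 𝔪 and its maximal ideal -/

section Endomorphisms

variable {R Q : Type u} [CommRing R] [IsLocalRing R] [CommRing Q] [Algebra R Q]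

theorem mem_maxSubmodule {A : Type u} [CommRing A] [IsLocalRing A] [Algebra A Q] {y : Q} :
    y ∈ maxSubmodule A Q ↔ ∃ r ∈ IsLocalRing.maximalIdeal A, algebraMap A Q r = y :=
  Iff.rfl

theorem maxSubmodule_le_one {A : Type u} [CommRing A] [IsLocalRing A] [Algebra A Q] :
    maxSubmodule A Q ≤ 1 := by
  rintro _ ⟨r, -, rfl⟩
  exact Submodule.mem_one.2 ⟨r, rfl⟩

theorem relLength_maxSubmodule_one {A : Type u} [CommRing A] [IsLocalRing A] [Algebra A Q]
    (hinj : Function.Injective (algebraMap A Q)) : relLength (maxSubmodule A Q) 1 = 1 := by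
  have h1 : (1 : Submodule A Q) = Submodule.map (Algebra.linearMap A Q) ⊤ := by
    rw [Submodule.one_eq_range, LinearMap.range_eq_map]
  rw [h1, maxSubmodule, relLength_map _ hinj, relLength_top, Module.length_eq_one_iff]
  exact isSimpleModule_iff_isCoatom.2 (Ideal.isMaximal_def.1 inferInstance)

variable (R Q) in
/-- The endomorphism ring `𝔪 : 𝔪`, as an `R`-submodule of the total ring of fractions. -/
def endoSubmodule : Submodule R Q := Subalgebra.toSubmodule (maxColonMax R Q)

theorem endoSubmodule_mul_self : endoSubmodule R Q * endoSubmodule R Q = endoSubmodule R Q :=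
  by
  rw [endoSubmodule]
  exact Subalgebra.isIdempotentElem_toSubmodule _

theorem one_le_endoSubmodule : 1 ≤ endoSubmodule R Q :=
  Submodule.one_le.2 (one_mem (maxColonMax R Q))

variable {α : R} {β : Qˣ}

/-- For r in 𝔪, r𝔪 ⊆ 𝔪² = α𝔪, so r/α lies in 𝔪 : 𝔪; conversely an element of 𝔪 : 𝔪 sends α into 𝔪.
-/
theorem maxSubmodule_eq_mul_endoSubmodule (hβ : (β : Q) = algebraMap R Q α)
    (hα : α ∈ IsLocalRing.maximalIdeal R)
    (hm : IsLocalRing.maximalIdeal R ^ 2 = Ideal.span {α} * IsLocalRing.maximalIdeal R) :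
    maxSubmodule R Q = unitSpan R β * endoSubmodule R Q := by
  ext y
  rw [mem_unitSpan_mul]
  constructor
  · rintro ⟨r, hr, rfl⟩ s hs
    have h1 : r * s ∈ Ideal.span {α} * IsLocalRing.maximalIdeal R := by
      rw [← hm, pow_two]
      exact Ideal.mul_mem_mul hr hs
    obtain ⟨t, ht, h2⟩ := Ideal.mem_span_singleton_mul.1 h1
    refine ⟨t, ht, ?_⟩
    rw [Algebra.linearMap_apply, mul_assoc, ← map_mul, ← h2, map_mul, ← hβ,
      Units.inv_mul_cancel_left]
  · intro h
    obtain ⟨s, hs, h1⟩ := h α hα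
    refine ⟨s, hs, ?_⟩
    rw [Algebra.linearMap_apply, ← h1, ← hβ, mul_comm, Units.mul_inv_cancel_left]

theorem map_span_singleton_mul {A : Type u} [CommRing A] [Algebra A Q] {x : A}
    (hβ : (β : Q) = algebraMap A Q x) (X : Ideal A) :
    Submodule.map (Algebra.linearMap A Q) (Ideal.span {x} * X) =
      unitSpan A β * Submodule.map (Algebra.linearMap A Q) X := by
  ext y
  rw [mem_unitSpan_mul]
  constructor
  · rintro ⟨r, hr, rfl⟩
    obtain ⟨t, ht, rfl⟩ := Ideal.mem_span_singleton_mul.1 hr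
    exact ⟨t, ht, by rw [Algebra.linearMap_apply, Algebra.linearMap_apply, map_mul, ← hβ,
      Units.inv_mul_cancel_left]⟩
  · rintro ⟨t, ht, h⟩
    refine ⟨x * t, Ideal.mem_span_singleton_mul.2 ⟨t, ht, rfl⟩, ?_⟩
    rw [Algebra.linearMap_apply] at h
    rw [Algebra.linearMap_apply, map_mul, h, ← hβ, Units.mul_inv_cancel_left]

theorem mem_nonZeroDivisors_of_unit {A : Type u} [CommRing A] [Algebra A Q]
    (hinj : Function.Injective (algebraMap A Q)) {x : A} (hβ : (β : Q) = algebraMap A Q x) :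
    x ∈ nonZeroDivisors A := by
  rw [mem_nonZeroDivisors_iff_right]
  intro r hr
  refine hinj ?_
  have := congrArg (algebraMap A Q) hr
  rwa [map_mul, ← hβ, map_zero, Units.mul_left_eq_zero, ← map_zero (algebraMap A Q)] at this

/-- In a local ring with `𝔪² = x𝔪`, the multiplicity is `ℓ (A / x A)`. -/
theorem relLength_unitSpan_mul_maxSubmodule {A : Type u} [CommRing A] [IsLocalRing A] [Algebra A Q]
    (hinj : Function.Injective (algebraMap A Q)) {x : A} (hβ : (β : Q) = algebraMap A Q x)
    (h : IsLocalRing.maximalIdeal A ^ 2 = Ideal.span {x} * IsLocalRing.maximalIdeal A)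
    {e : ℕ} (he : HasMultiplicity A e) :
    relLength (unitSpan A β * maxSubmodule A Q) (maxSubmodule A Q) = e := by
  have h1 := relLength_eq_of_hasMultiplicity (mem_nonZeroDivisors_of_unit hinj hβ) h he
  rwa [← relLength_map (Algebra.linearMap A Q) hinj, map_span_singleton_mul hβ] at h1

theorem relLength_mul_endoSubmodule (hinj : Function.Injective (algebraMap R Q))
    (hβ : (β : Q) = algebraMap R Q α) (hα : α ∈ IsLocalRing.maximalIdeal R)
    (hm : IsLocalRing.maximalIdeal R ^ 2 = Ideal.span {α} * IsLocalRing.maximalIdeal R)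
    {e : ℕ} (he : HasMultiplicity R e) :
    relLength (unitSpan R β * endoSubmodule R Q) (endoSubmodule R Q) = e := by
  have h1 := relLength_unitSpan_mul_maxSubmodule hinj hβ hm he
  rwa [maxSubmodule_eq_mul_endoSubmodule hβ hα hm, relLength_unitSpan_mul] at h1

theorem endoSubmodule_mul_maxSubmodule :
    endoSubmodule R Q * maxSubmodule R Q ≤ maxSubmodule R Q := by
  refine Submodule.mul_le.2 ?_
  rintro b hb _ ⟨r, hr, rfl⟩
  obtain ⟨s, hs, h⟩ := hb r hr
  exact ⟨s, hs, h.symm⟩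

theorem one_notMem_maxSubmodule (hinj : Function.Injective (algebraMap R Q)) :
    (1 : Q) ∉ maxSubmodule R Q := by
  rintro ⟨r, hr, h⟩
  have : r = 1 := hinj (h.trans (map_one _).symm)
  exact (Ideal.ne_top_iff_one _).1 (IsLocalRing.maximalIdeal.isMaximal _).ne_top (this ▸ hr)

variable [IsLocalRing (maxColonMax R Q)]

variable (R Q) in
/-- The maximal ideal of `𝔪 : 𝔪`, as an `R`-submodule of the total ring of fractions. -/
def endoMaxSubmodule : Submodule R Q :=
  (maxSubmodule (maxColonMax R Q) Q).restrictScalars R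

theorem mem_endoMaxSubmodule {y : Q} : y ∈ endoMaxSubmodule R Q ↔
    ∃ r ∈ IsLocalRing.maximalIdeal (maxColonMax R Q), (r : Q) = y :=
  Iff.rfl

theorem endoMaxSubmodule_le : endoMaxSubmodule R Q ≤ endoSubmodule R Q := by
  rintro y hy
  obtain ⟨r, -, rfl⟩ := mem_endoMaxSubmodule.1 hy
  exact r.2

theorem one_notMem_endoMaxSubmodule : (1 : Q) ∉ endoMaxSubmodule R Q := by
  intro h
  obtain ⟨r, hr, h1⟩ := mem_endoMaxSubmodule.1 h
  have : r = 1 := Subtype.ext h1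
  exact (Ideal.ne_top_iff_one _).1 (IsLocalRing.maximalIdeal.isMaximal _).ne_top (this ▸ hr)

theorem endoSubmodule_mul_endoMaxSubmodule :
    endoSubmodule R Q * endoMaxSubmodule R Q = endoMaxSubmodule R Q := by
  refine le_antisymm (Submodule.mul_le.2 ?_) ?_
  · intro b hb n hn
    obtain ⟨r, hr, rfl⟩ := mem_endoMaxSubmodule.1 hn
    exact mem_endoMaxSubmodule.2 ⟨⟨b, hb⟩ * r, Ideal.mul_mem_left _ _ hr, rfl⟩
  · intro y hy
    rw [← one_mul y]
    exact Submodule.mul_mem_mul (Submodule.one_le.1 one_le_endoSubmodule) hy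

theorem le_endoMaxSubmodule {X : Submodule R Q} (h1 : X ≤ endoSubmodule R Q)
    (h2 : endoSubmodule R Q * X ≤ X) (h3 : (1 : Q) ∉ X) : X ≤ endoMaxSubmodule R Q := by
  intro y hy
  refine mem_endoMaxSubmodule.2 ⟨⟨y, h1 hy⟩, ?_, rfl⟩
  rw [IsLocalRing.mem_maximalIdeal, mem_nonunits_iff]
  intro hu
  obtain ⟨w, hw⟩ := hu.exists_left_inv
  refine h3 ?_
  have h4 : (w : Q) * y = 1 := congrArg Subtype.val hw
  rw [← h4]
  exact h2 (Submodule.mul_mem_mul w.2 hy)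

theorem maxSubmodule_le_endoMaxSubmodule (hinj : Function.Injective (algebraMap R Q)) :
    maxSubmodule R Q ≤ endoMaxSubmodule R Q :=
  le_endoMaxSubmodule (maxSubmodule_le_one.trans one_le_endoSubmodule)
    endoSubmodule_mul_maxSubmodule (one_notMem_maxSubmodule hinj)

theorem endoMaxSubmodule_mul_self (hinj : Function.Injective (algebraMap R Q))
    (hβ : (β : Q) = algebraMap R Q α) (hα : α ∈ IsLocalRing.maximalIdeal R)
    (hn : IsLocalRing.maximalIdeal (maxColonMax R Q) ^ 2 =
      Ideal.span {algebraMap R (maxColonMax R Q) α} *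
        IsLocalRing.maximalIdeal (maxColonMax R Q)) :
    endoMaxSubmodule R Q * endoMaxSubmodule R Q = unitSpan R β * endoMaxSubmodule R Q := by
  refine le_antisymm (Submodule.mul_le.2 ?_) ?_
  · intro x hx y hy
    obtain ⟨x, hx', rfl⟩ := mem_endoMaxSubmodule.1 hx
    obtain ⟨y, hy', rfl⟩ := mem_endoMaxSubmodule.1 hy
    have h1 := Ideal.mul_mem_mul hx' hy'
    rw [← pow_two, hn] at h1
    obtain ⟨z, hz, h2⟩ := Ideal.mem_span_singleton_mul.1 h1
    rw [mem_unitSpan_mul]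
    refine mem_endoMaxSubmodule.2 ⟨z, hz, ?_⟩
    have h3 : algebraMap R Q α * (z : Q) = x * y := congrArg Subtype.val h2
    rw [← h3, ← hβ, Units.inv_mul_cancel_left]
  · refine mul_le_mul_left ?_ _
    rw [unitSpan, Submodule.span_singleton_le_iff_mem, hβ]
    exact maxSubmodule_le_endoMaxSubmodule hinj (algebraMap_mem_maxSubmodule hα)

/-- If `R` and `𝔪 : 𝔪` have the same multiplicity, they have the same residue field. -/
theorem relLength_endoMaxSubmodule_endoSubmodule (hinj : Function.Injective (algebraMap R Q))
    (hβ : (β : Q) = algebraMap R Q α) (hα : α ∈ IsLocalRing.maximalIdeal R)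
    (hm : IsLocalRing.maximalIdeal R ^ 2 = Ideal.span {α} * IsLocalRing.maximalIdeal R)
    (hn : IsLocalRing.maximalIdeal (maxColonMax R Q) ^ 2 =
      Ideal.span {algebraMap R (maxColonMax R Q) α} *
        IsLocalRing.maximalIdeal (maxColonMax R Q))
    {e : ℕ} (he : HasMultiplicity R e) (he' : HasMultiplicity (maxColonMax R Q) e) :
    relLength (endoMaxSubmodule R Q) (endoSubmodule R Q) = 1 := by
  have hinj' : Function.Injective (algebraMap (maxColonMax R Q) Q) := Subtype.val_injective
  have hβ' : (β : Q) = algebraMap (maxColonMax R Q) Q (algebraMap R (maxColonMax R Q) α) := hβ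
  set n' := maxSubmodule (maxColonMax R Q) Q with hn'
  have h1 : relLength (unitSpan (maxColonMax R Q) β * n') n' = e :=
    relLength_unitSpan_mul_maxSubmodule hinj' hβ' hn he'
  have h2 : relLength n' 1 = 1 := relLength_maxSubmodule_one hinj'
  have h3 : n' ≤ 1 := maxSubmodule_le_one
  have hmm := maxSubmodule_eq_mul_endoSubmodule hβ hα hm
  have h4 : (unitSpan (maxColonMax R Q) β * 1).restrictScalars R =
      unitSpan R β * endoSubmodule R Q := by
    ext y
    rw [Submodule.restrictScalars_mem, mem_unitSpan_mul, mem_unitSpan_mul, Submodule.mem_one]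
    exact ⟨fun ⟨r, hr⟩ => hr ▸ r.2, fun h => ⟨⟨_, h⟩, rfl⟩⟩
  have h5 : (unitSpan (maxColonMax R Q) β * 1) ≤ n' := by
    have := maxSubmodule_le_endoMaxSubmodule (Q := Q) hinj
    rw [hmm, ← h4] at this
    exact this
  -- Computing ℓ(B/β𝔫) over B through 𝔫 and through βB gives ℓ(𝔫/βB) = e - 1. Over R that length is
  -- at least e - 1, while ℓ(B/βB) = e, leaving at most one for B/𝔫.
  have h6 := relLength_add (mul_le_mul_right h3 (unitSpan (maxColonMax R Q) β)) (h5.trans h3)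
  rw [relLength_add (mul_le_mul_right h3 _ |>.trans h5) h3, relLength_unitSpan_mul, h1, h2,
    relLength_add h5 h3, h2] at h6
  have h7 := relLength_le_relLength_restrictScalars (R := R) (unitSpan (maxColonMax R Q) β * 1) n'
  rw [h4] at h7
  have h8 := relLength_mul_endoSubmodule hinj hβ hα hm he
  have h9 : unitSpan R β * endoSubmodule R Q ≤ endoMaxSubmodule R Q :=
    hmm ▸ maxSubmodule_le_endoMaxSubmodule hinj
  rw [relLength_add h9 endoMaxSubmodule_le] at h8
  have h10 : relLength (endoMaxSubmodule R Q) (endoSubmodule R Q) ≠ 0 := fun h =>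
    one_notMem_endoMaxSubmodule (relLength_eq_zero_iff.1 h (Submodule.one_le.1 one_le_endoSubmodule))
  change relLength _ _ ≤ relLength (unitSpan R β * endoSubmodule R Q) (endoMaxSubmodule R Q) at h7
  generalize relLength (unitSpan (maxColonMax R Q) β * 1) n' = p at *
  generalize relLength (unitSpan R β * endoSubmodule R Q) (endoMaxSubmodule R Q) = q at *
  generalize relLength (endoMaxSubmodule R Q) (endoSubmodule R Q) = r at *
  have hp : p ≠ ⊤ := by
    rintro rfl
    simp at h6
  have hq : q ≠ ⊤ := by
    rintro rfl
    simp at h8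
  have hr : r ≠ ⊤ := by
    rintro rfl
    simp at h8
  lift p to ℕ using hp
  lift q to ℕ using hq
  lift r to ℕ using hr
  norm_cast at *
  omega

end Endomorphisms

/-! ### Commensurable modules and canonical modules as fractional ideals -/

section Fractional

variable {A Q : Type u} [CommRing A] [CommRing Q] [Algebra A Q]

theorem Commensurable.of_le {z : Q} {X Y Z : Submodule A Q} (hX : Commensurable z X)
    (hZ : Commensurable z Z) (hXY : X ≤ Y) (hYZ : Y ≤ Z) : Commensurable z Y :=
  ⟨hX.1.imp fun _ h => hXY h, hZ.2.imp fun _ h y hy => h y (hYZ hy)⟩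

theorem Commensurable.fg [IsNoetherianRing A] {β : Qˣ} {X : Submodule A Q}
    (hX : Commensurable (β : Q) X) : X.FG := by
  obtain ⟨j, hj⟩ := hX.2
  have h1 : unitSpan A (β ^ j) * X ≤ 1 := by
    intro y hy
    rw [mem_unitSpan_mul] at hy
    have := hj _ hy
    rwa [← Units.val_pow_eq_pow_val, Units.mul_inv_cancel_left] at this
  have h2 : IsNoetherian A (1 : Submodule A Q) := by
    rw [Submodule.one_eq_range]
    infer_instance
  have h3 : (unitSpan A (β ^ j) * X).FG := by
    have := isNoetherian_of_le h1
    exact (Module.Finite.iff_fg).1 inferInstance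
  rw [← unitSpan_inv_mul_cancel (β ^ j) X]
  exact (Submodule.fg_span_singleton _).mul h3

theorem pow_succ_le_span_singleton_pow {m : Ideal A} {x : A} (h : m ^ 2 = Ideal.span {x} * m)
    (n : ℕ) : m ^ (n + 1) ≤ Ideal.span {x ^ n} := by
  have h1 : m ^ (n + 1) = Ideal.span {x ^ n} * m := by
    induction n with
    | zero => simp
    | succ n ih =>
      rw [pow_succ, ih, mul_assoc, ← pow_two, h, ← mul_assoc, Ideal.span_singleton_mul_span_singleton,
        ← pow_succ]
  rw [h1]
  exact Ideal.mul_le_left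

theorem Commensurable.div_div_eq [IsLocalRing A] {β : Qˣ} {x : A} (hβ : (β : Q) = algebraMap A Q x)
    (hinj : Function.Injective (algebraMap A Q))
    (hfin : ∀ n : ℕ, IsFiniteLength A (A ⧸ Ideal.span {x ^ n})) {L : Submodule A Q}
    (hL : L / L = 1) (hm : relLength L (L / maxSubmodule A Q) ≤ 1) {X : Submodule A Q}
    (hX : Commensurable (β : Q) X) : L / (L / X) = X := by
  obtain ⟨⟨i, hi⟩, ⟨j, hj⟩⟩ := hX
  rw [← Units.val_pow_eq_pow_val] at hi
  refine div_div_eq_of_relLength_ne_top hL hm hi ?_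
  have h1 : X ≤ unitSpan A (β ^ j)⁻¹ * 1 := by
    intro y hy
    rw [mem_unitSpan_mul, inv_inv, Units.val_pow_eq_pow_val]
    exact hj y hy
  refine ne_top_of_le_ne_top ?_ (relLength_mono_right _ h1)
  rw [← relLength_unitSpan_mul (β ^ j), unitSpan_mul_inv_cancel, unitSpan_mul, ← pow_add]
  have h2 : unitSpan A (β ^ (j + i)) =
      Submodule.map (Algebra.linearMap A Q) (Ideal.span {x ^ (j + i)}) := by
    rw [← mul_one (unitSpan A _), ← mul_one (Ideal.span _)]
    rw [Ideal.one_eq_top, map_span_singleton_mul (β := β ^ (j + i)) (by simp [hβ]), Submodule.one_eq_range,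
      LinearMap.range_eq_map]
  rw [h2, Submodule.one_eq_range, LinearMap.range_eq_map, relLength_map _ hinj, relLength_top]
  exact Module.length_ne_top_iff.2 (hfin _)

theorem ringKrullDim_eq_one [IsLocalRing A] [IsNoetherianRing A] {x : A}
    (hx : x ∈ nonZeroDivisors A) (hxm : x ∈ IsLocalRing.maximalIdeal A) {k : ℕ}
    (h : IsLocalRing.maximalIdeal A ^ k ≤ Ideal.span {x}) : ringKrullDim A = 1 := by
  have hnt : Nontrivial (A ⧸ Ideal.span {x}) := by
    refine Ideal.Quotient.nontrivial_iff.2 fun h => ?_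
    rw [Ideal.span_singleton_eq_top] at h
    exact hxm h
  have hfl := isFiniteLength_quotient_of_pow_le h
  rw [← Module.length_ne_top_iff, Module.length_eq_of_surjective (S := A)
    (R := A ⧸ Ideal.span {x}) Ideal.Quotient.mk_surjective, Module.length_ne_top_iff,
    isFiniteLength_iff_isNoetherian_isArtinian] at hfl
  have hart : IsArtinianRing (A ⧸ Ideal.span {x}) := hfl.2
  have h0 : ringKrullDim (A ⧸ Ideal.span {x}) = 0 :=
    ringKrullDimZero_iff_ringKrullDim_eq_zero.1 inferInstance
  rw [← ringKrullDim_quotient_span_singleton_succ_eq_ringKrullDim_of_mem_nonZeroDivisors hx hxm, h0,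
    zero_add]

theorem IsMaximalCohenMacaulay.exists_isSMulRegular [IsLocalRing A] {M : Type u} [AddCommGroup M]
    [Module A M] (h : IsMaximalCohenMacaulay A M) (hdim : ringKrullDim A = 1) :
    ∃ x ∈ IsLocalRing.maximalIdeal A, IsSMulRegular M x := by
  obtain ⟨rs, hrs, hreg, hlen⟩ := h.exists_regular
  rw [hdim] at hlen
  have hlen' : rs.length = 1 := by exact_mod_cast hlen
  obtain ⟨x, rfl⟩ := List.length_eq_one_iff.1 hlen'
  exact ⟨x, hrs x (by simp),
    ((RingTheory.Sequence.isWeaklyRegular_cons_iff M x []).1 hreg.toIsWeaklyRegular).1⟩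

/-- The element x divides t², and a divisor of a regular element is regular. -/
theorem isSMulRegular_of_sq_eq [IsLocalRing A] {M : Type u} [AddCommGroup M]
    [Module A M] {t x : A} (ht : t ∈ IsLocalRing.maximalIdeal A) (hreg : IsSMulRegular M t)
    (h : IsLocalRing.maximalIdeal A ^ 2 = Ideal.span {x} * IsLocalRing.maximalIdeal A) :
    IsSMulRegular M x := by
  have h1 : t * t ∈ Ideal.span {x} * IsLocalRing.maximalIdeal A := by
    rw [← h, pow_two]
    exact Ideal.mul_mem_mul ht ht
  obtain ⟨s, -, h2⟩ := Ideal.mem_span_singleton_mul.1 h1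
  have h3 : IsSMulRegular M (s * x) := by
    rw [mul_comm, h2]
    exact hreg.mul hreg
  exact h3.of_mul

theorem IsCanonicalModule.length_ext_one [IsLocalRing A] {ω : Type u} [AddCommGroup ω] [Module A ω]
    (h : IsCanonicalModule A ω) (hdim : ringKrullDim A = 1) :
    Module.length A (Abelian.Ext (ModuleCat.of A (IsLocalRing.ResidueField A))
      (ModuleCat.of A ω) 1) = 1 := by
  obtain ⟨d, hd, hlen⟩ := h.type_one
  rw [hdim] at hd
  have : d = 1 := by exact_mod_cast hd.symm
  rwa [this] at hlen

theorem nontrivial_of_length_eq_one {M : Type*} [AddCommGroup M] [Module A M]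
    (h : Module.length A M = 1) : Nontrivial M := by
  rw [← Module.length_pos_iff (R := A), h]
  exact one_pos

theorem IsCanonicalModule.div_self_eq_one_and [IsLocalRing A] [IsNoetherianRing A]
    {ω : Type u} [AddCommGroup ω] [Module A ω]
    (h : IsCanonicalModule A ω) {x : A} {β : Qˣ} (hβ : (β : Q) = algebraMap A Q x)
    (hinj : Function.Injective (algebraMap A Q))
    (hxm : x ∈ IsLocalRing.maximalIdeal A) {k : ℕ}
    (hk : IsLocalRing.maximalIdeal A ^ k ≤ Ideal.span {x}) {L : Submodule A Q}
    (h1 : 1 ≤ L) (hL : ∀ y ∈ L, x • y ∈ (1 : Submodule A Q)) (e : L ≃ₗ[A] ω) :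
    L / L = 1 ∧ relLength L (L / maxSubmodule A Q) ≤ 1 := by
  have hx := mem_nonZeroDivisors_of_unit hinj hβ
  have hxu : IsUnit (algebraMap A Q x) := ⟨β, hβ⟩
  have hext := h.length_ext_one (ringKrullDim_eq_one hx hxm hk)
  obtain ⟨n, hn⟩ := h.finite_injectiveDimension
  exact ⟨div_self_eq_one_of_canonical hx hxm (isFiniteLength_quotient_of_pow_le hk) hxu h1 hL e hn
    (nontrivial_of_length_eq_one hext), relLength_div_maxSubmodule_le_one hxm hxu e hext⟩

/-- An almost Gorenstein local ring `A` of dimension one with `𝔪² = x𝔪` has a canonical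
fractional ideal `L ⊇ A` with `𝔪 L ⊆ A`. -/
theorem IsAGL.exists_fractional [IsLocalRing A] (h : IsAGL A) {x : A} {β : Qˣ}
    (hβ : (β : Q) = algebraMap A Q x) (hinj : Function.Injective (algebraMap A Q))
    (hxm : x ∈ IsLocalRing.maximalIdeal A)
    (hx2 : IsLocalRing.maximalIdeal A ^ 2 = Ideal.span {x} * IsLocalRing.maximalIdeal A) :
    ∃ L : Submodule A Q, 1 ≤ L ∧ maxSubmodule A Q * L ≤ 1 ∧ L / L = 1 ∧
      relLength L (L / maxSubmodule A Q) ≤ 1 := by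
  obtain ⟨⟨hnoeth, -⟩, ω, _, _, hω, φ, hφ, hcoker⟩ := h
  have hx := mem_nonZeroDivisors_of_unit hinj hβ
  have hk : IsLocalRing.maximalIdeal A ^ 2 ≤ Ideal.span {x} := by
    rw [hx2]
    exact Ideal.mul_le_left
  have hmem : ∀ r ∈ IsLocalRing.maximalIdeal A, ∀ w : ω, r • w ∈ LinearMap.range φ := by
    intro r hr w
    have := hcoker r hr (Submodule.Quotient.mk w)
    rwa [← Submodule.Quotient.mk_smul, Submodule.Quotient.mk_eq_zero] at this
  obtain ⟨t, htm, ht⟩ := hω.maximal.exists_isSMulRegular (ringKrullDim_eq_one hx hxm hk)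
  have hxreg : IsSMulRegular ω x := isSMulRegular_of_sq_eq htm ht hx2
  let ε : A ≃ₗ[A] LinearMap.range φ := LinearEquiv.ofInjective φ hφ
  -- Since xω ⊆ φ(A), the map w ↦ φ⁻¹(xw)/x places ω in the fractions and sends φ(b) to b.
  let ψ : ω →ₗ[A] Q := LinearMap.mulLeft A (↑β⁻¹ : Q) ∘ₗ Algebra.linearMap A Q ∘ₗ
    ε.symm.toLinearMap ∘ₗ (LinearMap.lsmul A ω x).codRestrict (LinearMap.range φ) (hmem x hxm)
  have hψ : ∀ w b, φ b = x • w → ψ w = ↑β⁻¹ * algebraMap A Q b := by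
    intro w b hb
    have : ε.symm ⟨x • w, hmem x hxm w⟩ = b := by
      rw [LinearEquiv.symm_apply_eq]
      exact Subtype.ext hb.symm
    change ↑β⁻¹ * algebraMap A Q (ε.symm ⟨x • w, hmem x hxm w⟩) = _
    rw [this]
  have hψφ : ∀ b, ψ (φ b) = algebraMap A Q b := by
    intro b
    rw [hψ (φ b) (x * b) (by rw [← smul_eq_mul, map_smul]), map_mul, ← hβ,
      Units.inv_mul_cancel_left]
  have hψinj : Function.Injective ψ := by
    rw [← LinearMap.ker_eq_bot, LinearMap.ker_eq_bot']
    intro w hw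
    obtain ⟨b, hb⟩ := hmem x hxm w
    rw [hψ w b hb, Units.mul_right_eq_zero, ← map_zero (algebraMap A Q)] at hw
    rw [hinj hw, map_zero] at hb
    exact hxreg (hb.symm.trans (smul_zero x).symm)
  have hprod : ∀ r ∈ IsLocalRing.maximalIdeal A, ∀ y ∈ LinearMap.range ψ,
      r • y ∈ (1 : Submodule A Q) := by
    rintro r hr _ ⟨w, rfl⟩
    obtain ⟨b, hb⟩ := hmem r hr w
    rw [← map_smul, ← hb, hψφ]
    exact Submodule.mem_one.2 ⟨b, rfl⟩
  have h1 : 1 ≤ LinearMap.range ψ := Submodule.one_le.2 ⟨φ 1, by rw [hψφ, map_one]⟩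
  refine ⟨LinearMap.range ψ, h1, Submodule.mul_le.2 ?_, ?_⟩
  · rintro _ ⟨r, hr, rfl⟩ y hy
    rw [Algebra.linearMap_apply, ← Algebra.smul_def]
    exact hprod r hr y hy
  · exact hω.div_self_eq_one_and hβ hinj hxm hk h1 (hprod x hxm)
      (LinearEquiv.ofInjective ψ hψinj).symm

end Fractional

/-! ### The overrings 𝔪 : 𝔪 and 𝔫 : 𝔫 -/

section Tower

variable {R Q : Type u} [CommRing R] [CommRing Q] [Algebra R Q]

theorem div_mul_le (X Y : Submodule R Q) : X / Y * Y ≤ X :=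
  Submodule.le_div_iff_mul_le.1 le_rfl

theorem mul_div_le_div_of_mul_le {B X Y : Submodule R Q} (h : B * Y ≤ Y) : B * (X / Y) ≤ X / Y := by
  rw [Submodule.le_div_iff_mul_le, mul_comm B, mul_assoc]
  exact (mul_le_mul_right h _).trans (div_mul_le X Y)

variable [IsLocalRing R] [IsNoetherianRing R]

/-- Uniqueness of the canonical module, for fractional ideals of an overring `B` of `R`. -/
theorem exists_div_eq_unitSpan_mul {B n K L : Submodule R Q} {β : Qˣ} {α : R}
    (hβ : (β : Q) = algebraMap R Q α) (hα : α ∈ IsLocalRing.maximalIdeal R)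
    (hB1 : 1 ≤ B) (hBn : B * n ≤ n) (h1n : (1 : Q) ∉ n)
    (hnn : n * n = unitSpan R β * n) (hnB : n ≤ B)
    (hnmax : ∀ X : Submodule R Q, X ≤ B → B * X ≤ X → (1 : Q) ∉ X → X ≤ n)
    (hKdual : ∀ X : Submodule R Q, Commensurable (β : Q) X → K / (K / X) = X)
    (hLdual : ∀ X : Submodule R Q, Commensurable (β : Q) X → B * X ≤ X → L / (L / X) = X)
    (hLL : L / L = B) (hBL : B * L ≤ L)
    (hKc : Commensurable (β : Q) K) (hLc : Commensurable (β : Q) L)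
    (hnc : Commensurable (β : Q) n) :
    ∃ f : Qˣ, K / L = unitSpan R f * B := by
  set H := K / L with hH
  have hHc : Commensurable (β : Q) H := hKc.div hLc
  have hBH : B * H ≤ H := mul_div_le_div_of_mul_le hBL
  have hKH : K / H = L := hKdual L hLc
  have hLnc : Commensurable (β : Q) (L / n) := hLc.div hnc
  have hLn : L / (L / n) = n := hLdual n hnc hBn
  -- The candidate generator avoids K : (L : 𝔫), the dual counterpart of 𝔫H. Such an f exists, as
  -- otherwise L : 𝔫 ⊆ L and B ⊆ 𝔫.
  obtain ⟨f, hfH, hfM⟩ : ∃ f ∈ H, f ∉ K / (L / n) := by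
    by_contra! hcon
    have h1 : L / n ≤ L := by
      have := div_antitone K (show H ≤ K / (L / n) from hcon)
      rwa [hKH, hKdual _ hLnc] at this
    have h2 : B ≤ n := by
      rw [← hLL, ← hLn]
      exact div_antitone L h1
    exact h1n (h2 (Submodule.one_le.1 hB1))
  -- A B-submodule X of H containing f yields an ideal Y = L : (K : X) of B. It is not inside 𝔫 by
  -- the choice of f, so it contains 1, whence K : X ⊆ L and X = H.
  have hXmain : ∀ X : Submodule R Q, X ≤ H → B * X ≤ X → Commensurable (β : Q) X → f ∈ X →
      H ≤ X := by
    intro X hXH hBX hXc hfX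
    have hKXc : Commensurable (β : Q) (K / X) := hKc.div hXc
    have hBKX : B * (K / X) ≤ K / X := mul_div_le_div_of_mul_le hBX
    set Y := L / (K / X) with hY
    have hYB : Y ≤ B := by
      rw [← hLL]
      refine div_antitone L ?_
      rw [← hKH]
      exact div_antitone K hXH
    have h1Y : (1 : Q) ∈ Y := by
      by_contra h1
      have h2 : Y ≤ n := hnmax Y hYB (mul_div_le_div_of_mul_le hBKX) h1
      have h3 : L / n ≤ K / X := by
        rw [← hLdual _ hKXc hBKX]
        exact div_antitone L h2
      refine hfM (div_antitone K h3 ?_)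
      rwa [hKdual X hXc]
    have h4 : K / X ≤ L := Submodule.one_mem_div.1 h1Y
    rw [← hKdual X hXc]
    exact div_antitone K h4
  have hnH : n * H ≤ H := (mul_le_mul_left hnB H).trans hBH
  set F := B * Submodule.span R {f} with hF
  have hFH : F ≤ H := by
    refine (mul_le_mul_right ?_ B).trans hBH
    rwa [Submodule.span_singleton_le_iff_mem]
  have hfF : f ∈ F := by
    rw [← one_mul f]
    exact Submodule.mul_mem_mul (Submodule.one_le.1 hB1) (Submodule.mem_span_singleton_self f)
  have hBB : B * B ≤ B := by
    rw [← hLL, Submodule.le_div_iff_mul_le, mul_assoc]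
    exact (mul_le_mul_right (div_mul_le L L) _).trans (div_mul_le L L)
  have hBF : B * F ≤ F := by
    rw [hF, ← mul_assoc]
    exact mul_le_mul_left hBB _
  -- Bf is not yet known to be commensurable, f not being known to be a unit; adding 𝔫H repairs
  -- this.
  have h2 : H ≤ F ⊔ n * H := by
    refine hXmain _ (sup_le hFH hnH) ?_ ((hnc.mul hHc).of_le hHc le_sup_right (sup_le hFH hnH))
      (le_sup_left (a := F) hfF)
    rw [Submodule.mul_sup, ← mul_assoc B n H]
    exact sup_le_sup hBF (mul_le_mul_left hBn H)
  -- Iterating once and using 𝔫² = β𝔫 replaces 𝔫H by 𝔪H, so that Nakayama over R applies.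
  have h3 : H ≤ F ⊔ IsLocalRing.maximalIdeal R • H := by
    have h4 : n * H ≤ F ⊔ unitSpan R β * H := by
      calc n * H ≤ n * (F ⊔ n * H) := mul_le_mul_right h2 n
        _ = n * F ⊔ n * n * H := by rw [Submodule.mul_sup, mul_assoc]
        _ ≤ F ⊔ unitSpan R β * H := by
          refine sup_le_sup ((mul_le_mul_left hnB F).trans hBF) ?_
          rw [hnn, mul_assoc]
          exact mul_le_mul_right hnH _
    have h5 : unitSpan R β * H ≤ IsLocalRing.maximalIdeal R • H := by
      intro y hy
      rw [mem_unitSpan_mul] at hy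
      have : y = α • (↑β⁻¹ * y) := by
        rw [Algebra.smul_def, ← hβ, Units.mul_inv_cancel_left]
      rw [this]
      exact Submodule.smul_mem_smul hα hy
    exact h2.trans (sup_le le_sup_left (h4.trans (sup_le_sup_left h5 F)))
  have h6 : H = F :=
    le_antisymm (Submodule.le_of_le_smul_of_le_jacobson_bot hHc.fg
      (IsLocalRing.maximalIdeal_le_jacobson _) h3) hFH
  -- Some power of `β` lies in H = fB, so f divides a unit.
  have hfu : IsUnit f := by
    obtain ⟨i, hi⟩ := hHc.1
    rw [h6, hF, mul_comm, Submodule.mem_span_singleton_mul] at hi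
    obtain ⟨b, -, hb⟩ := hi
    refine isUnit_of_mul_isUnit_left (y := b) ?_
    rw [hb, ← Units.val_pow_eq_pow_val]
    exact Units.isUnit _
  obtain ⟨f, rfl⟩ := hfu
  exact ⟨f, by rw [h6, hF, mul_comm]; rfl⟩

/-- The overring `A = 𝔫 : 𝔫` of `B = 𝔪 : 𝔪` satisfies `K A = A` and `K : A = R : A = 𝔪 𝔫`. -/
theorem mul_le_and_div_eq_of_tower {m B n K L : Submodule R Q} {β : Qˣ} {α : R}
    (hβ : (β : Q) = algebraMap R Q α) (hα : α ∈ IsLocalRing.maximalIdeal R)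
    (hm1 : m ≤ 1) (hmmax : ∀ X : Submodule R Q, X ≤ 1 → (1 : Q) ∉ X → X ≤ m)
    (hmB : m = unitSpan R β * B)
    (hB1 : 1 ≤ B) (hBn : B * n ≤ n) (h1n : (1 : Q) ∉ n)
    (hnn : n * n = unitSpan R β * n) (hnB : n ≤ B) (hmn : m ≤ n) (hne : ¬ n ≤ m)
    (hnmax : ∀ X : Submodule R Q, X ≤ B → B * X ≤ X → (1 : Q) ∉ X → X ≤ n)
    (hKK : K / K = 1) {N : ℕ} (hKN : K ^ (N + 1) = K ^ N)
    (hKdual : ∀ X : Submodule R Q, Commensurable (β : Q) X → K / (K / X) = X)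
    (hLdual : ∀ X : Submodule R Q, Commensurable (β : Q) X → B * X ≤ X → L / (L / X) = X)
    (h1L : 1 ≤ L) (hLL : L / L = B) (hnL : n * L ≤ B)
    (hKc : Commensurable (β : Q) K) :
    K ≤ unitSpan R β⁻¹ * n ∧ K / (unitSpan R β⁻¹ * n) = unitSpan R β * n := by
  have hBL : B * L ≤ L := by
    rw [← hLL]
    exact div_mul_le L L
  have hβm : (β : Q) ∈ m := by
    rw [hmB, mem_unitSpan_mul, Units.inv_mul]
    exact Submodule.one_le.1 hB1
  have hmc : Commensurable (β : Q) m :=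
    ⟨⟨1, by simpa using hβm⟩, ⟨0, fun y hy => by simpa using hm1 hy⟩⟩
  have hBc : Commensurable (β : Q) B := by
    refine ⟨⟨0, by simpa using Submodule.one_le.1 hB1⟩, ⟨1, fun y hy => hm1 ?_⟩⟩
    rw [hmB, mem_unitSpan_mul]
    simpa using hy
  have hnc : Commensurable (β : Q) n := hmc.of_le hBc hmn hnB
  have hβL : unitSpan R β * L ≤ B := by
    refine (mul_le_mul_left ?_ L).trans hnL
    rw [unitSpan, Submodule.span_singleton_le_iff_mem]
    exact hmn hβm
  have hLc : Commensurable (β : Q) L := by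
    refine ⟨⟨0, by simpa using Submodule.one_le.1 h1L⟩, ?_⟩
    refine ⟨2, fun y hy => hm1 ?_⟩
    rw [hmB, mem_unitSpan_mul, pow_two, mul_assoc, Units.inv_mul_cancel_left]
    refine hβL ?_
    rw [mem_unitSpan_mul, Units.inv_mul_cancel_left]
    exact hy
  set A := unitSpan R β⁻¹ * n with hA
  have hnA : n = unitSpan R β * A := by rw [hA, unitSpan_mul_inv_cancel]
  have hnAn : n * A = n := by
    rw [hA, mul_left_comm, hnn, unitSpan_inv_mul_cancel]
  have hAA : A * A = A := by
    conv_lhs => rw [hA, mul_assoc, hnAn]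
  have hBA : B ≤ A := by
    rw [hA, ← unitSpan_inv_mul_cancel β B, ← hmB]
    exact mul_le_mul_right hmn _
  have h1A : 1 ≤ A := hB1.trans hBA
  have hAB : ¬ A ≤ B := by
    intro h
    refine hne ?_
    rw [hnA, hmB]
    exact mul_le_mul_right h _
  have hAc : Commensurable (β : Q) A := by
    refine hBc.of_le (Z := L / n) (hLc.div hnc) hBA ?_
    rw [Submodule.le_div_iff_mul_le, mul_comm, hnAn]
    exact hnB.trans (by simpa [hLL] using (mul_le_mul_right h1L B).trans hBL)
  -- An A-stable submodule of B containing 1 would contain A, but A ⊄ B because 𝔫 ⊄ 𝔪.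
  have hstab : ∀ X : Submodule R Q, X ≤ B → A * X ≤ X → X ≤ n := by
    intro X hXB hAX
    refine hnmax X hXB ((mul_le_mul_left hBA X).trans hAX) fun h1 => hAB ?_
    calc A = A * 1 := (mul_one A).symm
      _ ≤ A * X := mul_le_mul_right (Submodule.one_le.2 h1) A
      _ ≤ B := hAX.trans hXB
  have hBL' : B ≤ L := by simpa using (mul_le_mul_right h1L B).trans hBL
  -- Here the AGL property of B enters: 𝔫L lies in B and is A-stable since 𝔫A = 𝔫, so 𝔫L ⊆ 𝔫; in
  -- particular βL ⊆ 𝔫 = βA.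
  have hLA : L ≤ A := by
    have h1 : n * L ≤ n := by
      refine hstab _ hnL ?_
      rw [← mul_assoc, mul_comm A, hnAn]
    rw [hA, ← unitSpan_mul_le_iff]
    refine (mul_le_mul_left ?_ L).trans h1
    rw [unitSpan, Submodule.span_singleton_le_iff_mem]
    exact hmn hβm
  have hLdivA : L / A = n := by
    refine le_antisymm (hstab _ ?_ (mul_div_le_div_of_mul_le hAA.le)) ?_
    · rw [← hLL]
      exact div_antitone L hLA
    · rw [Submodule.le_div_iff_mul_le, hnAn]
      exact hnB.trans hBL'
  obtain ⟨f, hf⟩ := exists_div_eq_unitSpan_mul hβ hα hB1 hBn h1n hnn hnB hnmax hKdual hLdual hLL hBL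
    hKc hLc hnc
  have hKB : K / B = unitSpan R f * L := by
    have h1 := hKdual L hLc
    rw [hf, div_unitSpan_mul] at h1
    rw [← h1, unitSpan_mul_inv_cancel]
  have hBA' : B * A = A :=
    le_antisymm ((mul_le_mul_left hBA A).trans hAA.le) (by simpa using mul_le_mul_left hB1 A)
  -- K : A = (K : B) : A = f(L : A) = f𝔫.
  have hKA : K / A = unitSpan R (f * β) * A := by
    rw [← hBA', div_mul_eq, hKB, unitSpan_mul_div, hLdivA, hnA, ← mul_assoc, unitSpan_mul, hBA']
  have h1A' : (1 : Submodule R Q) / A = unitSpan R β * n := by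
    refine le_antisymm ?_ ?_
    · set X := (1 : Submodule R Q) / A with hX
      have hAX : A * X ≤ X := mul_div_le_div_of_mul_le hAA.le
      have hX1 : X ≤ 1 := by
        have := div_antitone (1 : Submodule R Q) h1A
        rw [← hX] at this
        refine this.trans ?_
        simpa using div_mul_le (1 : Submodule R Q) 1
      have hXm : X ≤ m := by
        refine hmmax X hX1 fun h1 => hAB ?_
        calc A = A * 1 := (mul_one A).symm
          _ ≤ A * X := mul_le_mul_right (Submodule.one_le.2 h1) A
          _ ≤ B := hAX.trans (hX1.trans hB1)
      have h2 : unitSpan R β⁻¹ * X ≤ n := by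
        refine hstab _ ?_ ?_
        · rw [unitSpan_mul_le_iff, inv_inv, ← hmB]
          exact hXm
        · rw [mul_left_comm]
          exact mul_le_mul_right hAX _
      rwa [unitSpan_mul_le_iff, inv_inv] at h2
    · rw [Submodule.le_div_iff_mul_le, mul_assoc, hnAn]
      refine (mul_le_mul_right hnB _).trans ?_
      rw [← hmB]
      exact hm1
  have hKAc : Commensurable (β : Q) (K * A) := hKc.mul hAc
  -- K : KA = R : A = β²A, and KA is recovered as K : β²A = β⁻²(K : A).
  obtain ⟨h, hh⟩ : ∃ h : Qˣ, K * A = unitSpan R h * A := by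
    refine ⟨(β * β)⁻¹ * (f * β), ?_⟩
    rw [← hKdual _ hKAc, div_mul_eq, hKK, h1A', hnA, ← mul_assoc, unitSpan_mul, div_unitSpan_mul,
      hKA, ← mul_assoc, unitSpan_mul]
  have hpow : ∀ k : ℕ, K ^ k * A = unitSpan R (h ^ k) * A := by
    intro k
    induction k with
    | zero => simp [unitSpan_one]
    | succ k ih => rw [pow_succ, mul_assoc, hh, mul_left_comm, ih, ← mul_assoc, unitSpan_mul, pow_succ']
  -- Kᴺ⁺¹ = Kᴺ gives hᴺ(KA) = hᴺA, and the unit hᴺ cancels.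
  have hKAA : K * A = A := by
    have h1 := hpow (N + 1)
    rw [hKN, hpow N, pow_succ, ← unitSpan_mul, mul_assoc, ← hh] at h1
    have h2 := congrArg (unitSpan R (h ^ N)⁻¹ * ·) h1
    simp only [unitSpan_inv_mul_cancel] at h2
    exact h2.symm
  refine ⟨?_, ?_⟩
  · calc K = K * 1 := (mul_one K).symm
      _ ≤ K * A := mul_le_mul_right h1A K
      _ = A := hKAA
  · rw [← h1A', ← hKK, ← div_mul_eq, hKAA]

end Tower

/-! ### The fractional ideal K = I/a and the ring R[K] -/

section FracIdeal

variable {R Q : Type u} [CommRing R] [CommRing Q] [Algebra R Q]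

theorem fracIdeal_eq {I : Ideal R} {a : R} {ζ : Qˣ} (hζ : (ζ : Q) = algebraMap R Q a) :
    fracIdeal Q I a = unitSpan R ζ⁻¹ * Submodule.map (Algebra.linearMap R Q) I := by
  ext y
  rw [mem_unitSpan_mul, inv_inv, hζ]
  exact ⟨fun ⟨x, hx, h⟩ => ⟨x, hx, h.symm⟩, fun ⟨x, hx, h⟩ => ⟨x, hx, h.symm⟩⟩

theorem unitSpan_pow (ζ : Qˣ) (n : ℕ) : unitSpan R (ζ ^ n) = unitSpan R ζ ^ n := by
  induction n with
  | zero => simp [unitSpan_one]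
  | succ n ih => rw [pow_succ, pow_succ, ← ih, unitSpan_mul]

theorem unitSpan_pow_mul_fracIdeal_pow {I : Ideal R} {a : R} {ζ : Qˣ}
    (hζ : (ζ : Q) = algebraMap R Q a) (n : ℕ) :
    unitSpan R (ζ ^ n) * fracIdeal Q I a ^ n = Submodule.map (Algebra.linearMap R Q) (I ^ n) := by
  rw [fracIdeal_eq hζ, mul_pow, ← unitSpan_pow, ← mul_assoc, unitSpan_mul, inv_pow, mul_inv_cancel,
    unitSpan_one, one_mul]
  exact (Submodule.map_pow I (Algebra.ofId R Q) n).symm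

theorem fracIdeal_pow_succ_eq {I : Ideal R} {a : R} {ζ : Qˣ} (hζ : (ζ : Q) = algebraMap R Q a)
    {n : ℕ} (h : I ^ (n + 1) = Ideal.span {a} * I ^ n) :
    fracIdeal Q I a ^ (n + 1) = fracIdeal Q I a ^ n := by
  have h1 := unitSpan_pow_mul_fracIdeal_pow (I := I) hζ (n + 1)
  rw [h, map_span_singleton_mul hζ, ← unitSpan_pow_mul_fracIdeal_pow hζ, ← mul_assoc, unitSpan_mul,
    ← pow_succ'] at h1
  have h2 := congrArg (unitSpan R (ζ ^ (n + 1))⁻¹ * ·) h1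
  simpa only [unitSpan_inv_mul_cancel] using h2

theorem one_le_fracIdeal {I : Ideal R} {a : R} (ha : a ∈ I) : 1 ≤ fracIdeal Q I a :=
  Submodule.one_le.2 ⟨a, ha, mul_one _⟩

theorem smul_mem_one_of_mem_fracIdeal {I : Ideal R} {a : R} {y : Q} (hy : y ∈ fracIdeal Q I a) :
    a • y ∈ (1 : Submodule R Q) := by
  obtain ⟨x, -, h⟩ := hy
  exact Submodule.mem_one.2 ⟨x, by rw [Algebra.smul_def, h]⟩

/-- The fractional ideal `I / a` is isomorphic to `I`. -/
noncomputable def fracIdealEquiv (hinj : Function.Injective (algebraMap R Q)) (I : Ideal R) {a : R}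
    {ζ : Qˣ} (hζ : (ζ : Q) = algebraMap R Q a) : fracIdeal Q I a ≃ₗ[R] I :=
  (LinearEquiv.ofBijective
    ((LinearMap.mulLeft R (↑ζ⁻¹ : Q) ∘ₗ Algebra.linearMap R Q ∘ₗ I.subtype).codRestrict
      (fracIdeal Q I a) (fun x => ⟨x, x.2, by
        change _ * (_ * algebraMap R Q x) = _
        rw [← hζ, Units.mul_inv_cancel_left]⟩))
    (by
      constructor
      · intro x y h
        have h1 : ↑ζ⁻¹ * algebraMap R Q x = ↑ζ⁻¹ * algebraMap R Q y := congrArg Subtype.val h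
        exact Subtype.ext (hinj ((Units.mul_right_inj _).1 h1))
      · rintro ⟨y, x, hx, h⟩
        refine ⟨⟨x, hx⟩, Subtype.ext ?_⟩
        change ↑ζ⁻¹ * algebraMap R Q x = y
        rw [← h, ← hζ, Units.inv_mul_cancel_left])).symm

theorem isAGL_of_maxSubmodule_mul_le [IsLocalRing R] (hCM : IsCohenMacaulayLocal R) {I : Ideal R}
    (hI : IsCanonicalModule R I) (hinj : Function.Injective (algebraMap R Q)) {a : R} (ha : a ∈ I)
    {ζ : Qˣ} (hζ : (ζ : Q) = algebraMap R Q a)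
    (h : maxSubmodule R Q * fracIdeal Q I a ≤ 1) : IsAGL R := by
  refine ⟨hCM, I, inferInstance, inferInstance, hI, LinearMap.toSpanSingleton R I ⟨a, ha⟩, ?_, ?_⟩
  · intro r s hrs
    exact (mul_cancel_right_mem_nonZeroDivisors (mem_nonZeroDivisors_of_unit hinj hζ)).1
      (congrArg Subtype.val hrs)
  · intro r hr c
    obtain ⟨x, rfl⟩ := Submodule.Quotient.mk_surjective _ c
    rw [← Submodule.Quotient.mk_smul, Submodule.Quotient.mk_eq_zero]
    have h1 : (↑ζ⁻¹ * algebraMap R Q x : Q) ∈ fracIdeal Q I a :=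
      ⟨x, x.2, by rw [← hζ, Units.mul_inv_cancel_left]⟩
    obtain ⟨s, hs⟩ := Submodule.mem_one.1
      (h (Submodule.mul_mem_mul (algebraMap_mem_maxSubmodule hr) h1))
    refine ⟨s, Subtype.ext (hinj ?_)⟩
    change algebraMap R Q (s * a) = algebraMap R Q (r * x)
    rw [map_mul, map_mul, hs, ← hζ, mul_assoc, mul_comm _ (ζ : Q),
      Units.mul_inv_cancel_left]

theorem mem_conductor_iff {S : Subalgebra R Q} {r : R} :
    r ∈ conductor Q S ↔ algebraMap R Q r ∈ (1 : Submodule R Q) / Subalgebra.toSubmodule S := by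
  rw [Submodule.mem_div_iff_forall_mul_mem]
  simp only [Submodule.mem_one, Subalgebra.mem_toSubmodule]
  exact ⟨fun h s hs => (h s hs).imp fun _ => Eq.symm, fun h s hs => (h s hs).imp fun _ => Eq.symm⟩

/-- As 1 ∈ K the powers increase; once stationary, Kⁿ is closed under multiplication and is the
whole ring R[K]. -/
theorem adjoin_eq_of_pow_eq {K : Submodule R Q} (h1 : 1 ≤ K) {n : ℕ} (h : K ^ (n + 1) = K ^ n) :
    Subalgebra.toSubmodule (Algebra.adjoin R (K : Set Q)) = K ^ n := by
  have hstab : ∀ k, K ^ (n + k) = K ^ n := by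
    intro k
    induction k with
    | zero => rfl
    | succ k ih => rw [← add_assoc, pow_succ, ih, ← pow_succ, h]
  have h1n : (1 : Q) ∈ K ^ n := Submodule.one_le.1 (one_le_pow₀ h1)
  refine le_antisymm ?_ ?_
  · let T : Subalgebra R Q := (K ^ n).toSubalgebra h1n (fun x y hx hy => by
      rw [← hstab n, pow_add]
      exact Submodule.mul_mem_mul hx hy)
    have h2 : Algebra.adjoin R (K : Set Q) ≤ T := by
      refine Algebra.adjoin_le fun y hy => ?_
      change y ∈ K ^ n
      rw [← h, pow_succ, ← one_mul y]
      exact Submodule.mul_mem_mul h1n hy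
    exact h2
  · have : K ^ n ≤ Subalgebra.toSubmodule (Algebra.adjoin R (K : Set Q)) ^ n :=
      pow_le_pow_left' (fun y hy => Algebra.subset_adjoin hy) n
    refine this.trans ?_
    rcases Nat.eq_zero_or_pos n with rfl | hn
    · rw [pow_zero]
      exact Submodule.one_le.2 (one_mem (Algebra.adjoin R (K : Set Q)))
    · rw [(Subalgebra.isIdempotentElem_toSubmodule _).pow_eq hn.ne']

end FracIdeal

/-! ### Proper submodules of R -/

section Tower

variable {R Q : Type u} [CommRing R] [IsLocalRing R] [CommRing Q] [Algebra R Q]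

theorem le_maxSubmodule {X : Submodule R Q} (h1 : X ≤ 1) (h : (1 : Q) ∉ X) :
    X ≤ maxSubmodule R Q := by
  intro y hy
  obtain ⟨r, rfl⟩ := Submodule.mem_one.1 (h1 hy)
  refine mem_maxSubmodule.2 ⟨r, ?_, rfl⟩
  rw [IsLocalRing.mem_maximalIdeal, mem_nonunits_iff]
  intro hu
  obtain ⟨s, hs⟩ := hu.exists_left_inv
  refine h ?_
  rw [← map_one (algebraMap R Q), ← hs, map_mul, ← Algebra.smul_def]
  exact X.smul_mem s hy

end Tower

/-! ### Length count in the tower -/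

section Lengths

variable {R Q : Type u} [CommRing R] [IsLocalRing R] [CommRing Q] [Algebra R Q]

/-- The lengths in the tower `R ⊆ K ⊆ A`, where `𝔪 = β B`, `𝔫 = β A`. -/
theorem relLength_of_tower {B n A K : Submodule R Q} {β : Qˣ}
    (hnA : n = unitSpan R β * A) (hmB : maxSubmodule R Q = unitSpan R β * B)
    (hB1 : 1 ≤ B) (hBB : B * B = B) (hBA : B ≤ A) (hBA' : B * A = A) (h1n : (1 : Q) ∉ n)
    (hnB : n ≤ B) (hmn : maxSubmodule R Q ≤ n)
    {e : ℕ} (he : 3 ≤ e) (lmB : relLength (maxSubmodule R Q) B = e) (lnB : relLength n B = 1)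
    (lm1 : relLength (maxSubmodule R Q) 1 = 1)
    (hKK : K / K = 1) (h1K : 1 ≤ K) (hKm : relLength K (K / maxSubmodule R Q) ≤ 1)
    (hKA : K ≤ A) (hKdivA : K / A = unitSpan R β * n)
    (dK : K / (K / K) = K) (dA : K / (K / A) = A) (dBK : K / (K / (B * K)) = B * K) :
    relLength (unitSpan R β * n) (maxSubmodule R Q) = 1 ∧
    relLength K A = 2 ∧ relLength 1 K = (2 * (e - 2) : ℕ) ∧
      relLength (1 ⊔ maxSubmodule R Q * K) K = (e - 2 : ℕ) := by
  set m := maxSubmodule R Q with hm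
  have hm1 : m ≤ 1 := maxSubmodule_le_one
  have lβ : relLength (unitSpan R β * n) m = 1 := by rw [hmB, relLength_unitSpan_mul, lnB]
  have hβm : unitSpan R β * n ≤ m := by
    rw [hmB]
    exact mul_le_mul_right hnB _
  -- Duality turns A/K into R/β𝔫, which is filtered by 𝔪/β𝔫 and R/𝔪.
  have lKA : relLength K A = 2 := by
    rw [← relLength_div_eq hKm hKA dK dA, hKdivA, hKK, relLength_add hβm hm1, lβ, lm1]
    exact one_add_one_eq_two
  have l1B : relLength m B = relLength m 1 + relLength 1 B := relLength_add hm1 hB1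
  have lmn : relLength m n = relLength B A := by rw [hmB, hnA, relLength_unitSpan_mul]
  have lmnB : relLength m B = relLength m n + relLength n B := relLength_add hmn hnB
  have l1A : relLength 1 A = relLength 1 B + relLength B A := relLength_add hB1 hBA
  have l1A' : relLength 1 A = relLength 1 K + relLength K A := relLength_add h1K hKA
  have hBK : B ≤ B * K := by simpa using mul_le_mul_right h1K B
  have hKBK : K ≤ B * K := by simpa using mul_le_mul_left hB1 K
  have hBKA : B * K ≤ A := (mul_le_mul_right hKA B).trans hBA'.le
  have h1B : (1 : Submodule R Q) / B = m := by
    refine le_antisymm ?_ ?_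
    · have hle : (1 : Submodule R Q) / B ≤ 1 := by
        refine (div_antitone 1 hB1).trans ?_
        simpa using div_mul_le (1 : Submodule R Q) 1
      refine le_maxSubmodule hle fun h => ?_
      -- If B ⊆ R, then ℓ(B/𝔪) would be 1 instead of e.
      rw [relLength_eq_zero_iff.2 (Submodule.one_mem_div.1 h), lm1, lmB] at l1B
      norm_cast at l1B
      omega
    · rw [Submodule.le_div_iff_mul_le, hmB, mul_assoc, hBB, ← hmB]
      exact hm1
  -- The dual of BK is (K : K) : B = R : B = 𝔪, so BK/K is dual to R/𝔪.
  have lKBK : relLength K (B * K) = 1 := by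
    rw [← relLength_div_eq hKm hKBK dK dBK, hKK, mul_comm, div_mul_eq, hKK, h1B, lm1]
  have l1BK : relLength 1 (B * K) = relLength 1 K + relLength K (B * K) := relLength_add h1K hKBK
  have l1BK' : relLength 1 (B * K) = relLength 1 B + relLength B (B * K) := relLength_add hB1 hBK
  have lmK : relLength m (m * K) = relLength B (B * K) := by
    rw [hmB, mul_assoc, relLength_unitSpan_mul]
  -- 𝔪K = βBK ⊆ βA = 𝔫 does not contain 1.
  have hinf : 1 ⊓ m * K = m := by
    refine le_antisymm (le_maxSubmodule inf_le_left fun h => h1n ?_) (le_inf hm1 ?_)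
    · have : m * K ≤ n := by
        rw [hmB, mul_assoc, hnA]
        exact mul_le_mul_right hBKA _
      exact this h.2
    · simpa using mul_le_mul_right h1K m
  have lsup : relLength 1 (1 ⊔ m * K) = relLength B (B * K) := by
    rw [relLength_sup, ← relLength_inf, hinf, lmK]
  have hsupK : 1 ⊔ m * K ≤ K := by
    refine sup_le h1K ?_
    simpa using mul_le_mul_left hm1 K
  have lfin : relLength 1 K = relLength 1 (1 ⊔ m * K) + relLength (1 ⊔ m * K) K :=
    relLength_add le_sup_left hsupK
  refine ⟨lβ, lKA, ?_⟩
  -- Balance: ℓ(B/R) = ℓ(A/B) = e - 1, so ℓ(A/R) = 2e - 2, ℓ(K/R) = 2e - 4 and ℓ(BK/R) = 2e - 3.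
  -- Hence ℓ(BK/B) = e - 2 = ℓ((R + 𝔪K)/R), and e - 2 remains for K/(R + 𝔪K).
  rw [lsup] at lfin
  rw [lKBK] at l1BK
  rw [lKA] at l1A'
  rw [lmB, lm1] at l1B
  rw [lmB, lmn, lnB] at lmnB
  clear lKA lKBK lβ lmK lsup lmB lm1 lnB lmn hKm
  generalize relLength 1 B = p at *
  generalize relLength B A = q at *
  generalize relLength 1 A = r at *
  generalize relLength 1 K = s at *
  generalize relLength 1 (B * K) = t at *
  generalize relLength B (B * K) = u at *
  generalize relLength (1 ⊔ m * K) K = v at *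
  have hp : p ≠ ⊤ := by rintro rfl; simp at l1B
  have hq : q ≠ ⊤ := by rintro rfl; simp at lmnB
  lift p to ℕ using hp
  lift q to ℕ using hq
  have hr : r ≠ ⊤ := by rw [l1A]; exact ENat.natCast_ne_top (p + q)
  have hs : s ≠ ⊤ := by rintro rfl; rw [l1A'] at hr; simp at hr
  have hv : v ≠ ⊤ := by rintro rfl; rw [lfin] at hs; simp at hs
  have hu : u ≠ ⊤ := by rintro rfl; rw [lfin] at hs; simp at hs
  lift r to ℕ using hr
  lift s to ℕ using hs
  lift u to ℕ using hu
  lift v to ℕ using hv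
  rw [l1BK] at l1BK'
  norm_cast at *
  omega

end Lengths

/-! ### Identification of R[K] with 𝔫 : 𝔫 -/

section Assembly

variable {R Q : Type u} [CommRing R] [IsLocalRing R] [IsNoetherianRing R] [CommRing Q]
  [Algebra R Q] [IsFractionRing R Q]

/-- A regular element of 𝔪 has a power divisible by the parameter a, so a is regular. -/
theorem exists_nonZeroDivisor_pow_le (hCM : IsCohenMacaulayLocal R) (hdim : ringKrullDim R = 1)
    {a : R} (ha : (Ideal.span {a}).radical = IsLocalRing.maximalIdeal R) :
    a ∈ nonZeroDivisors R ∧ ∃ k, IsLocalRing.maximalIdeal R ^ k ≤ Ideal.span {a} := by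
  obtain ⟨t, htm, ht⟩ := hCM.maximal.exists_isSMulRegular hdim
  constructor
  · rw [← ha] at htm
    obtain ⟨n, hn⟩ := htm
    obtain ⟨s, hs⟩ := Ideal.mem_span_singleton'.1 hn
    have h1 : IsSMulRegular R a := IsSMulRegular.of_mul (a := s) (by
      rw [hs]
      exact ht.pow n)
    rw [mem_nonZeroDivisors_iff_right]
    intro r hr
    exact h1 (by simpa [mul_comm] using hr)
  · obtain ⟨k, hk⟩ := Ideal.exists_radical_pow_le_of_fg (Ideal.span {a})
      (IsNoetherian.noetherian _)
    exact ⟨k, by rwa [ha] at hk⟩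

omit [IsNoetherianRing R] [IsFractionRing R Q] in
theorem mem_nonZeroDivisors_of_sq_eq (hCM : IsCohenMacaulayLocal R) (hdim : ringKrullDim R = 1)
    {α : R} (hm : IsLocalRing.maximalIdeal R ^ 2 = Ideal.span {α} * IsLocalRing.maximalIdeal R) :
    α ∈ nonZeroDivisors R := by
  obtain ⟨t, htm, ht⟩ := hCM.maximal.exists_isSMulRegular hdim
  have h1 : IsSMulRegular R α := isSMulRegular_of_sq_eq htm ht hm
  rw [mem_nonZeroDivisors_iff_right]
  intro r hr
  exact h1 (by simpa [mul_comm] using hr)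

/-- The structure of `R ⊆ K ⊆ A = R[K]` for `A = 𝔫 : 𝔫`. -/
theorem exists_overring_structure (hCM : IsCohenMacaulayLocal R) (hdim : ringKrullDim R = 1)
    (I : Ideal R) (hIcan : IsCanonicalModule R I) (a : R)
    (ha : (Ideal.span {a}).radical = IsLocalRing.maximalIdeal R)
    (hred : IsReduction (Ideal.span {a}) I)
    (e : ℕ) (he : 3 ≤ e) (heR : HasMultiplicity R e) (hR : ¬ IsAGL R)
    [IsLocalRing (maxColonMax R Q)] (hB : IsAGL (maxColonMax R Q))
    (heB : HasMultiplicity (maxColonMax R Q) e)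
    (α : R) (hα : α ∈ IsLocalRing.maximalIdeal R)
    (hm : IsLocalRing.maximalIdeal R ^ 2 = Ideal.span {α} * IsLocalRing.maximalIdeal R)
    (hn : IsLocalRing.maximalIdeal (maxColonMax R Q) ^ 2 =
      Ideal.span {algebraMap R (maxColonMax R Q) α} *
        IsLocalRing.maximalIdeal (maxColonMax R Q)) :
    ∃ (n r : ℕ), fracIdeal Q I a ≤ fracIdeal Q I a ^ n ∧
      fracIdeal Q I a ^ (n + 1) = fracIdeal Q I a ^ n ∧
      relLength (fracIdeal Q I a) (fracIdeal Q I a ^ n) = 2 ∧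
      Module.length R
        (R ⧸ conductor Q (Algebra.adjoin R (fracIdeal Q I a : Set Q))) = 2 ∧
      relLength 1 (fracIdeal Q I a) = 2 * r ∧
      relLength (1 ⊔ maxSubmodule R Q * fracIdeal Q I a) (fracIdeal Q I a) = r ∧
      (fracIdeal Q I a).FG := by
  have hinj : Function.Injective (algebraMap R Q) := IsFractionRing.injective R Q
  obtain ⟨haz, k, hk⟩ := exists_nonZeroDivisor_pow_le hCM hdim ha
  have hαz := mem_nonZeroDivisors_of_sq_eq hCM hdim hm
  obtain ⟨ζ, hζ⟩ : IsUnit (algebraMap R Q a) := IsLocalization.map_units Q ⟨a, haz⟩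
  obtain ⟨β, hβ⟩ : IsUnit (algebraMap R Q α) := IsLocalization.map_units Q ⟨α, hαz⟩
  have ham : a ∈ IsLocalRing.maximalIdeal R := by
    rw [← ha]
    exact Ideal.le_radical (Ideal.mem_span_singleton_self a)
  have haI : a ∈ I := hred.1 (Ideal.mem_span_singleton_self a)
  obtain ⟨-, N, hN⟩ := hred
  set K := fracIdeal Q I a with hK
  have h1K : 1 ≤ K := one_le_fracIdeal haI
  have h1K' : (1 : Q) ∈ K := Submodule.one_le.1 h1K
  have hKN : K ^ (N + 1) = K ^ N := fracIdeal_pow_succ_eq hζ hN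
  obtain ⟨hKK, hKm⟩ := hIcan.div_self_eq_one_and hζ hinj ham hk h1K
    (fun y hy => smul_mem_one_of_mem_fracIdeal hy) (fracIdealEquiv hinj I hζ)
  have hnotAGL : ¬ maxSubmodule R Q * K ≤ 1 := fun h =>
    hR (isAGL_of_maxSubmodule_mul_le hCM hIcan hinj haI hζ h)
  have hKc : Commensurable (β : Q) K := by
    refine ⟨⟨0, by simpa using h1K'⟩, ⟨k, fun y hy => ?_⟩⟩
    obtain ⟨s, hs⟩ := Ideal.mem_span_singleton'.1 (hk (Ideal.pow_mem_pow hα k))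
    rw [hβ, ← map_pow, ← hs, map_mul, mul_assoc, ← Algebra.smul_def, ← Algebra.smul_def]
    exact Submodule.smul_mem _ _ (smul_mem_one_of_mem_fracIdeal hy)
  have hfinR : ∀ i : ℕ, IsFiniteLength R (R ⧸ Ideal.span {α ^ i}) := fun i =>
    isFiniteLength_quotient_of_pow_le (pow_succ_le_span_singleton_pow hm i)
  have hKdual : ∀ X : Submodule R Q, Commensurable (β : Q) X → K / (K / X) = X := fun X hX =>
    hX.div_div_eq hβ hinj hfinR hKK hKm
  have hinjB : Function.Injective (algebraMap (maxColonMax R Q) Q) := Subtype.val_injective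
  have hβB : (β : Q) = algebraMap (maxColonMax R Q) Q (algebraMap R (maxColonMax R Q) α) := hβ
  have hαB : algebraMap R (maxColonMax R Q) α ∈ IsLocalRing.maximalIdeal (maxColonMax R Q) := by
    obtain ⟨r, hr, h⟩ := mem_endoMaxSubmodule.1
      (maxSubmodule_le_endoMaxSubmodule hinj (algebraMap_mem_maxSubmodule (Q := Q) hα))
    have : r = algebraMap R (maxColonMax R Q) α := Subtype.ext h
    rwa [← this]
  obtain ⟨L, h1L, hnL, hLL, hLm⟩ := hB.exists_fractional hβB hinjB hαB hn
  have : IsNoetherianRing (maxColonMax R Q) := hB.cohenMacaulay.noetherian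
  have hfinB : ∀ i : ℕ, IsFiniteLength (maxColonMax R Q)
      (maxColonMax R Q ⧸ Ideal.span {algebraMap R (maxColonMax R Q) α ^ i}) := fun i =>
    isFiniteLength_quotient_of_pow_le (pow_succ_le_span_singleton_pow hn i)
  set m := maxSubmodule R Q with hmdef
  set B := endoSubmodule R Q with hBdef
  set n := endoMaxSubmodule R Q with hndef
  set L' := L.restrictScalars R with hL'def
  have hone : (1 : Submodule (maxColonMax R Q) Q).restrictScalars R = B := by
    ext y
    rw [Submodule.restrictScalars_mem, Submodule.mem_one]
    exact ⟨fun ⟨r, hr⟩ => hr ▸ r.2, fun h => ⟨⟨y, h⟩, rfl⟩⟩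
  have hmB : m = unitSpan R β * B := maxSubmodule_eq_mul_endoSubmodule hβ hα hm
  have hB1 : 1 ≤ B := one_le_endoSubmodule
  have hLdual : ∀ X : Submodule R Q, Commensurable (β : Q) X → B * X ≤ X →
      L' / (L' / X) = X := by
    intro X hX hBX
    -- A B-stable R-submodule is a B-submodule, and colons in the fractions do not depend on the
    -- base ring.
    let X' : Submodule (maxColonMax R Q) Q :=
      { X with smul_mem' := fun b x hx => hBX (Submodule.mul_mem_mul b.2 hx) }
    have hX' : Commensurable (β : Q) X' := by
      refine ⟨hX.1, hX.2.imp fun j hj y hy => ?_⟩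
      have : β.val ^ j * y ∈ B := hB1 (hj y hy)
      rwa [← hone] at this
    have h1 := hX'.div_div_eq hβB hinjB hfinB hLL hLm
    exact congrArg (Submodule.restrictScalars R) h1
  have hLL' : L' / L' = B := by
    rw [← hone, ← hLL]
    rfl
  have hnL' : n * L' ≤ B := by
    refine Submodule.mul_le.2 fun x hx y hy => ?_
    rw [← hone]
    exact hnL (Submodule.mul_mem_mul hx hy)
  have hBn : B * n = n := endoSubmodule_mul_endoMaxSubmodule
  have hnB : n ≤ B := endoMaxSubmodule_le
  have hmn : m ≤ n := maxSubmodule_le_endoMaxSubmodule hinj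
  have hnn : n * n = unitSpan R β * n := endoMaxSubmodule_mul_self hinj hβ hα hn
  have h1n : (1 : Q) ∉ n := one_notMem_endoMaxSubmodule
  have hm1 : m ≤ 1 := maxSubmodule_le_one
  have lmB : relLength m B = e := by
    rw [hmB]
    exact relLength_mul_endoSubmodule hinj hβ hα hm heR
  have lnB : relLength n B = 1 :=
    relLength_endoMaxSubmodule_endoSubmodule hinj hβ hα hm hn heR heB
  have lm1 : relLength m 1 = 1 := relLength_maxSubmodule_one hinj
  have hnm : ¬ n ≤ m := by
    intro h
    rw [le_antisymm h hmn, lmB] at lnB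
    norm_cast at lnB
    omega
  obtain ⟨hKA, hKdivA⟩ := mul_le_and_div_eq_of_tower hβ hα hm1 (fun X h1 h2 => le_maxSubmodule h1 h2)
    hmB hB1 hBn.le h1n hnn hnB hmn hnm (fun X h1 h2 h3 => le_endoMaxSubmodule h1 h2 h3) hKK hKN
    hKdual hLdual (Submodule.one_le.2 (show (1 : Q) ∈ L from Submodule.one_le.1 h1L)) hLL' hnL' hKc
  set A := unitSpan R β⁻¹ * n with hA
  have hnA : n = unitSpan R β * A := by rw [hA, unitSpan_mul_inv_cancel]
  have hBB : B * B = B := endoSubmodule_mul_self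
  have hBA : B ≤ A := by
    rw [hA, ← unitSpan_inv_mul_cancel β B, ← hmB]
    exact mul_le_mul_right hmn _
  have hBA' : B * A = A := by rw [hA, mul_left_comm, hBn]
  have hβm : (β : Q) ∈ m := by
    rw [hβ]
    exact algebraMap_mem_maxSubmodule hα
  have hBc : Commensurable (β : Q) B := by
    refine ⟨⟨0, by simpa using Submodule.one_le.1 hB1⟩, ⟨1, fun y hy => hm1 ?_⟩⟩
    rw [hmB, mem_unitSpan_mul]
    simpa using hy
  have hAA : A * A = A := by
    rw [hA, mul_mul_mul_comm, hnn, unitSpan_mul, ← mul_assoc, unitSpan_mul, inv_mul_cancel_right]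
  have hAc : Commensurable (β : Q) A := by
    refine ⟨hBc.1.imp fun _ h => hBA h, ⟨2, fun y hy => hm1 ?_⟩⟩
    rw [hmB, mem_unitSpan_mul, pow_two, mul_assoc, Units.inv_mul_cancel_left]
    refine hnB ?_
    rwa [hnA, mem_unitSpan_mul, Units.inv_mul_cancel_left]
  obtain ⟨lβ, lKA, l1K, lgen⟩ := relLength_of_tower hnA hmB hB1 hBB hBA hBA' h1n hnB hmn he lmB lnB
    lm1 hKK h1K hKm hKA hKdivA (hKdual K hKc) (hKdual A hAc) (hKdual _ (hBc.mul hKc))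
  set S := K ^ N with hS
  have hKS : K * S = S := by rw [hS, ← pow_succ', hKN]
  have h1S : 1 ≤ S := one_le_pow₀ h1K
  have hKleS : K ≤ S := by
    rw [← hKS]
    simpa using mul_le_mul_right h1S K
  have h1A : 1 ≤ A := hB1.trans hBA
  have hSA : S ≤ A := (pow_le_pow_left' hKA N).trans (by
    rcases Nat.eq_zero_or_pos N with rfl | hpos
    · simpa using h1A
    · rw [IsIdempotentElem.pow_eq hAA hpos.ne'])
  -- KS = S and K : K = R.
  have hKdivS : K / S = 1 / S := by
    conv_lhs => rw [← hKS, div_mul_eq, hKK]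
  -- β𝔫 ⊆ R : S ⊆ 𝔪 with ℓ(𝔪/β𝔫) = 1 leaves two choices; R : S = 𝔪 would give 𝔪K ⊆ R, making R AGL.
  have h1S' : (1 : Submodule R Q) / S = unitSpan R β * n := by
    have h1 : unitSpan R β * n ≤ 1 / S := by
      rw [← hKdivA, ← hKdivS]
      exact div_antitone K hSA
    have h2 : (1 : Submodule R Q) / S ≤ m := by
      refine le_maxSubmodule ((div_antitone 1 h1S).trans (by
        simpa using div_mul_le (1 : Submodule R Q) 1)) fun h => hnotAGL ?_
      have hK1 : K ≤ 1 := hKleS.trans (Submodule.one_mem_div.1 h)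
      calc m * K ≤ 1 * 1 := mul_le_mul' hm1 hK1
        _ = 1 := one_mul 1
    have h3 : relLength (1 / S) m ≠ 0 := by
      intro h
      have h4 : m ≤ 1 / S := relLength_eq_zero_iff.1 h
      exact hnotAGL ((mul_le_mul_right hKleS m).trans (Submodule.le_div_iff_mul_le.1 h4))
    rw [relLength_add h1 h2] at lβ
    refine (le_antisymm h1 (relLength_eq_zero_iff.1 ?_)).symm
    generalize relLength (unitSpan R β * n) (1 / S) = p at *
    generalize relLength (1 / S) m = q at *
    have hp : p ≠ ⊤ := by rintro rfl; simp at lβ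
    have hq : q ≠ ⊤ := by rintro rfl; simp at lβ
    lift p to ℕ using hp
    lift q to ℕ using hq
    norm_cast at *
    omega
  -- S and A have the same K-dual β𝔫.
  have hSeqA : S = A := by
    rw [← hKdual A hAc, hKdivA, ← h1S', ← hKdivS]
    exact (hKdual S ⟨⟨0, by simpa using Submodule.one_le.1 h1S⟩,
      hAc.2.imp fun j hj y hy => hj y (hSA hy)⟩).symm
  have hcond : relLength (1 / S) 1 = Module.length R
      (R ⧸ conductor Q (Algebra.adjoin R (K : Set Q))) := by
    have h1 : Submodule.map (Algebra.linearMap R Q)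
        (conductor Q (Algebra.adjoin R (K : Set Q))) = 1 / S := by
      ext y
      constructor
      · rintro ⟨r, hr, rfl⟩
        have := mem_conductor_iff.1 hr
        rwa [adjoin_eq_of_pow_eq h1K hKN] at this
      · intro hy
        have hy1 : y ∈ (1 : Submodule R Q) := by
          simpa using Submodule.mem_div_iff_forall_mul_mem.1 hy 1 (Submodule.one_le.1 h1S)
        obtain ⟨r, rfl⟩ := Submodule.mem_one.1 hy1
        refine ⟨r, mem_conductor_iff.2 ?_, rfl⟩
        rwa [adjoin_eq_of_pow_eq h1K hKN]
    rw [← h1, Submodule.one_eq_range, LinearMap.range_eq_map, relLength_map _ hinj, relLength_top]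
  refine ⟨N, e - 2, hKleS, hKN, ?_, ?_, ?_, lgen, hKc.fg⟩
  · exact (congrArg (relLength K) hSeqA).trans lKA
  · rw [← hcond, h1S', relLength_add ?_ hm1, lβ, lm1]
    · exact one_add_one_eq_two
    · rw [hmB]
      exact mul_le_mul_right hnB _
  · rw [l1K]
    push_cast
    rfl

end Assembly

/-! ### A freeness criterion by length -/

section Free

variable {R M : Type*} [CommRing R] [IsLocalRing R] [AddCommGroup M] [Module R M]

theorem exists_le_sup_span_of_relLength_eq {Y : Submodule R M} (r : ℕ) :
    ∀ {X : Submodule R M}, X ≤ Y → relLength X Y = r →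
      ∃ v : Fin r → M, (∀ i, v i ∈ Y) ∧ Y ≤ X ⊔ Submodule.span R (Set.range v) := by
  induction r with
  | zero =>
    intro X _ h
    exact ⟨Fin.elim0, fun i => i.elim0, le_sup_of_le_left (relLength_eq_zero_iff.1 h)⟩
  | succ r ih =>
    intro X hXY h
    have hle : ¬ Y ≤ X := fun h' => by
      rw [relLength_eq_zero_iff.2 h'] at h
      norm_cast at h
    obtain ⟨y, hyY, hyX, hy⟩ := exists_smul_mem_of_relLength_ne_top
      (by rw [h]; exact ENat.natCast_ne_top _) hle
    have h1 : X ⊔ Submodule.span R {y} ≤ Y :=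
      sup_le hXY (by rwa [Submodule.span_singleton_le_iff_mem])
    have hone : relLength X (X ⊔ Submodule.span R {y}) = 1 :=
      relLength_eq_one_of_forall_smul_mem le_rfl hy fun h' =>
        hyX (h' (Submodule.mem_sup_right (Submodule.mem_span_singleton_self y)))
    rw [relLength_add le_sup_left h1, hone] at h
    obtain ⟨v, hv, hY⟩ := ih h1 (by
      generalize relLength (X ⊔ Submodule.span R {y}) Y = q at *
      have hq : q ≠ ⊤ := by
        rintro rfl
        simp at h
        exact absurd h (by exact_mod_cast (ENat.natCast_ne_top (r + 1)).symm)
      lift q to ℕ using hq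
      norm_cast at *
      omega)
    refine ⟨Fin.cons y v, fun i => ?_, hY.trans ?_⟩
    · refine Fin.cases ?_ ?_ i
      · simpa using hyY
      · intro i
        simpa using hv i
    · rw [Fin.range_cons, Set.insert_eq, Submodule.span_union, sup_assoc]

/-- A quotient `Y / X` of length `2 r` with `r` generators that is killed by an ideal `c` of
colength `2` is free over `R / c`. -/
theorem nonempty_equiv_of_relLength {X Y : Submodule R M} (hXY : X ≤ Y) (hY : Y.FG) {c : Ideal R}
    (hc : Module.length R (R ⧸ c) = 2) (hcY : ∀ s ∈ c, ∀ y ∈ Y, s • y ∈ X) {r : ℕ}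
    (h1 : relLength X Y = 2 * r)
    (h2 : relLength (X ⊔ IsLocalRing.maximalIdeal R • Y) Y = r) :
    Nonempty ((Y ⧸ X.submoduleOf Y) ≃ₗ[R] (Fin r → R ⧸ c)) := by
  obtain ⟨v, hv, hYv⟩ := exists_le_sup_span_of_relLength_eq r
    (sup_le hXY Submodule.smul_le_right) h2
  -- Nakayama lifts generators of Y/(X + 𝔪Y) to generators of Y/X.
  have hYv' : Y ≤ X ⊔ Submodule.span R (Set.range v) := by
    refine Submodule.le_of_le_smul_of_le_jacobson_bot hY (IsLocalRing.maximalIdeal_le_jacobson _) ?_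
    rwa [sup_right_comm] at hYv
  let w : Fin r → Y ⧸ X.submoduleOf Y := fun i => Submodule.Quotient.mk ⟨v i, hv i⟩
  let f : (Fin r → R ⧸ c) →ₗ[R] (Y ⧸ X.submoduleOf Y) :=
    ∑ i, (Submodule.liftQ c (LinearMap.toSpanSingleton R _ (w i)) (fun s hs =>
      (Submodule.Quotient.mk_eq_zero (X.submoduleOf Y)).2 (hcY s hs _ (hv i)))) ∘ₗ LinearMap.proj i
  have hf : ∀ s : Fin r → R, f (fun i => Submodule.Quotient.mk (s i)) = ∑ i, s i • w i := by
    intro s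
    simp only [f, LinearMap.sum_apply]
    rfl
  have hsurj : Function.Surjective f := by
    intro z
    obtain ⟨⟨y, hy⟩, rfl⟩ := Submodule.Quotient.mk_surjective _ z
    obtain ⟨x, hx, u, hu, rfl⟩ := Submodule.mem_sup.1 (hYv' hy)
    obtain ⟨s, rfl⟩ := (Submodule.mem_span_range_iff_exists_fun R).1 hu
    refine ⟨fun i => Submodule.Quotient.mk (s i), ?_⟩
    rw [hf]
    have h3 : ∑ i, s i • w i = Submodule.Quotient.mk (∑ i, s i • (⟨v i, hv i⟩ : Y)) :=
      (map_sum (Submodule.mkQ _) _ _).symm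
    rw [h3, Submodule.Quotient.eq]
    change ((∑ i, s i • (⟨v i, hv i⟩ : Y) : Y) : M) - (x + ∑ i, s i • v i) ∈ X
    rw [Submodule.coe_sum, sub_add_eq_sub_sub_swap]
    simpa using hx
  have hlen : Module.length R (Fin r → R ⧸ c) = 2 * r := by
    rw [Module.length_pi_of_fintype]
    simp [hc, mul_comm]
  -- Source and target both have finite length 2r, so the kernel of the surjection has length zero.
  have hinj : Function.Injective f := by
    rw [← LinearMap.ker_eq_bot, ← Submodule.subsingleton_iff_eq_bot,
      ← Module.length_eq_zero_iff (R := R)]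
    have h3 := Module.length_eq_add_of_exact (LinearMap.ker f).subtype f
      (Submodule.subtype_injective _) hsurj (LinearMap.exact_subtype_ker_map f)
    have h4 : Module.length R (Y ⧸ X.submoduleOf Y) = 2 * r := h1
    rw [hlen, h4] at h3
    generalize Module.length R (LinearMap.ker f) = q at *
    have hq : q ≠ ⊤ := by
      rintro rfl
      rw [top_add] at h3
      exact absurd h3 (by exact_mod_cast ENat.natCast_ne_top (2 * r))
    lift q to ℕ using hq
    norm_cast at *
    omega
  exact ⟨(LinearEquiv.ofBijective f ⟨hinj, hsurj⟩).symm⟩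

end Free

theorem maxSubmodule_mul_eq_smul {R Q : Type u} [CommRing R] [IsLocalRing R] [CommRing Q]
    [Algebra R Q] (X : Submodule R Q) :
    maxSubmodule R Q * X = IsLocalRing.maximalIdeal R • X := by
  refine le_antisymm (Submodule.mul_le.2 ?_) (Submodule.smul_le.2 ?_)
  · rintro _ ⟨r, hr, rfl⟩ x hx
    rw [Algebra.linearMap_apply, ← Algebra.smul_def]
    exact Submodule.smul_mem_smul hr hx
  · intro r hr x hx
    rw [Algebra.smul_def]
    exact Submodule.mul_mem_mul (algebraMap_mem_maxSubmodule hr) hx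

/-! ### Length two after localization at a prime -/

section LocalizedLength

variable {T : Type*} [CommRing T] {p : Ideal T} [p.IsPrime] {M : Type*} [AddCommGroup M] [Module T M]

/-- Up to a multiplier outside p, Y is X plus a cyclic module whose generator is killed modulo X
exactly by p; locally this quotient is the residue field. -/
theorem relLength_localized_eq_one {X Y : Submodule T M} {y : M} (hy : y ∈ Y)
    (hY : ∃ u ∉ p, ∀ z ∈ Y, u • z ∈ X ⊔ Submodule.span T {y})
    (hp : ∀ r ∈ p, r • y ∈ X) (hne : ∀ t ∉ p, t • y ∉ X) :
    relLength (X.localized p.primeCompl) (Y.localized p.primeCompl) = 1 := by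
  set f := LocalizedModule.mkLinearMap p.primeCompl M with hf
  have hX : ∀ x ∈ X, ∀ s : p.primeCompl, LocalizedModule.mk x s ∈ X.localized p.primeCompl :=
    fun x hx s => (Submodule.mem_localized' _ _ _ _ _).2
      ⟨x, hx, s, (IsLocalizedModule.mk_eq_mk' s x).symm⟩
  refine relLength_eq_one_of_forall_smul_mem (R := Localization.AtPrime p) (y := f y) ?_ ?_ ?_
  · obtain ⟨u, hu, hz⟩ := hY
    intro w hw
    obtain ⟨z, hzY, s, rfl⟩ := (Submodule.mem_localized' _ _ _ _ _).1 hw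
    obtain ⟨x, hx, v, hv, hxv⟩ := Submodule.mem_sup.1 (hz z hzY)
    obtain ⟨t, rfl⟩ := Submodule.mem_span_singleton.1 hv
    rw [← IsLocalizedModule.mk_eq_mk']
    have h1 : (LocalizedModule.mk z s : LocalizedModule p.primeCompl M) =
        LocalizedModule.mk x (⟨u, hu⟩ * s) +
          Localization.mk t (⟨u, hu⟩ * s) • LocalizedModule.mk y 1 := by
      rw [LocalizedModule.mk_smul_mk, mul_one, LocalizedModule.mk_add_mk, ← smul_add,
        LocalizedModule.mk_cancel_common_left, hxv]
      exact (LocalizedModule.mk_cancel_common_left ⟨u, hu⟩ s z).symm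
    rw [h1]
    exact Submodule.add_mem_sup (hX x hx _)
      (Submodule.smul_mem _ _ (Submodule.mem_span_singleton_self _))
  · have h1 : IsLocalRing.maximalIdeal (Localization.AtPrime p) ≤
        (X.localized p.primeCompl).comap
          (LinearMap.toSpanSingleton (Localization.AtPrime p) _ (f y)) := by
      rw [← Localization.AtPrime.map_eq_maximalIdeal]
      refine Ideal.map_le_iff_le_comap.2 fun r hr => ?_
      change algebraMap T (Localization.AtPrime p) r • f y ∈ X.localized p.primeCompl
      rw [algebraMap_smul, ← map_smul]
      exact hX _ (hp r hr) 1
    exact fun r hr => h1 hr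
  · intro hle
    have h1 : f y ∈ X.localized p.primeCompl :=
      hle ((Submodule.mem_localized' _ _ _ _ _).2 ⟨y, hy, 1, by simp [f]⟩)
    obtain ⟨x, hx, s, hxs⟩ := (Submodule.mem_localized' _ _ _ _ _).1 h1
    rw [← IsLocalizedModule.mk_eq_mk'] at hxs
    obtain ⟨c, hc⟩ := LocalizedModule.mk_eq.1 (hxs : _ = LocalizedModule.mk y 1)
    refine hne ((c : T) * s) (c * s).2 ?_
    have h2 : ((c : T) * s) • y = (c : T) • x := by
      rw [mul_smul]
      simpa [Submonoid.smul_def] using hc.symm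
    rw [h2]
    exact X.smul_mem _ hx

theorem length_localizedModule_eq_two {ξ η : M} (hξ : ∀ r ∈ p, r • ξ = 0)
    (hη : ∀ r ∈ p, r • η ∈ Submodule.span T {ξ})
    (hu : ∃ u ∉ p, ∀ z : M, u • z ∈ Submodule.span T {ξ} ⊔ Submodule.span T {η})
    (hξ' : ∀ t ∉ p, t • ξ ≠ 0) (hη' : ∀ t ∉ p, t • η ∉ Submodule.span T {ξ}) :
    Module.length (Localization.AtPrime p) (LocalizedModule p.primeCompl M) = 2 := by
  have h1 := relLength_localized_eq_one (p := p) (X := ⊥) (Submodule.mem_span_singleton_self ξ)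
    ⟨1, p.one_notMem, fun z hz => by simpa using hz⟩ (by simpa using hξ) (by simpa using hξ')
  have h2 := relLength_localized_eq_one (p := p) (X := Submodule.span T {ξ}) (Y := ⊤) (y := η)
    trivial (hu.imp fun u h => ⟨h.1, fun z _ => h.2 z⟩) hη hη'
  have htop : (⊤ : Submodule T M).localized p.primeCompl = ⊤ := Submodule.localized'_top _ _ _
  have hbot : (⊥ : Submodule T M).localized p.primeCompl = ⊥ := Submodule.localized'_bot _ _ _
  rw [htop] at h2
  rw [hbot] at h1
  have h3 := relLength_add (bot_le : ⊥ ≤ (Submodule.span T {ξ}).localized p.primeCompl) le_top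
  rw [h1, h2, relLength_top] at h3
  rw [← (Submodule.quotEquivOfEqBot (⊥ : Submodule (Localization.AtPrime p) _) rfl).length_eq]
  exact h3.trans one_add_one_eq_two

end LocalizedLength

/-! ### R[Qt] as a polynomial ring, and graded pieces of I·R[Jt] -/

section ReesAlgebra

variable {R : Type u} [CommRing R]

/-- The homomorphism `R[X] → R[Qt]`, `X ↦ a t`, for `Q = (a)`. -/
noncomputable def polynomialToRees (a : R) : R[X] →+* Rees (Ideal.span {a}) :=
  (Polynomial.compRingHom (C a * X)).codRestrict (reesAlgebra (Ideal.span {a})) (fun g => by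
    rw [mem_reesAlgebra_iff]
    intro i
    rw [coe_compRingHom_apply, comp_C_mul_X_coeff, Ideal.span_singleton_pow]
    exact Ideal.mul_mem_left _ _ (Ideal.mem_span_singleton_self _))

theorem polynomialToRees_smul (a : R) (g f : R[X]) :
    polynomialToRees a g • f = g.comp (C a * X) * f := rfl

/-- The degree i part of R[Qt] is (aⁱ)tⁱ, free on aⁱtⁱ because a is regular. -/
theorem polynomialToRees_bijective {a : R} (ha : a ∈ nonZeroDivisors R) :
    Function.Bijective (polynomialToRees a) := by
  constructor
  · intro g h hgh
    have h1 : g.comp (C a * X) = h.comp (C a * X) := congrArg Subtype.val hgh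
    ext i
    have h2 := congrArg (fun f => coeff f i) h1
    simp only [comp_C_mul_X_coeff] at h2
    exact (mul_cancel_right_mem_nonZeroDivisors (pow_mem ha i)).1 h2
  · rintro ⟨f, hf⟩
    have h1 : ∀ i, ∃ c, c * a ^ i = f.coeff i := fun i => by
      have := (mem_reesAlgebra_iff _ _).1 hf i
      rwa [Ideal.span_singleton_pow, Ideal.mem_span_singleton'] at this
    choose c hc using h1
    refine ⟨∑ i ∈ f.support, monomial i (c i), Subtype.ext ?_⟩
    change (∑ i ∈ f.support, monomial i (c i)).comp (C a * X) = f
    ext j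
    rw [comp_C_mul_X_coeff, finsetSum_coeff]
    simp only [coeff_monomial, Finset.sum_ite_eq', mem_support_iff]
    split_ifs with h
    · exact hc j
    · rw [zero_mul, notMem_support_iff.1 h]

theorem reesMax_eq_map [IsLocalRing R] (a : R) : reesMax (Ideal.span {a}) =
    ((IsLocalRing.maximalIdeal R).map (C : R →+* R[X])).map (polynomialToRees a) := by
  rw [Ideal.map_map, reesMax]
  congr 1
  ext r : 1
  refine Subtype.ext ?_
  change C r = (C r).comp (C a * X)
  simp

theorem reesMax_isPrime [IsLocalRing R] {a : R} (ha : a ∈ nonZeroDivisors R) :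
    (reesMax (Ideal.span {a})).IsPrime := by
  rw [reesMax_eq_map]
  have := Ideal.isPrime_map_C_of_isPrime (P := IsLocalRing.maximalIdeal R)
  exact Ideal.map_isPrime_of_equiv
    (RingEquiv.ofBijective (polynomialToRees a) (polynomialToRees_bijective ha))

theorem polynomialToRees_mem_reesMax [IsLocalRing R] {a : R} (ha : a ∈ nonZeroDivisors R)
    {g : R[X]} : polynomialToRees a g ∈ reesMax (Ideal.span {a}) ↔
      ∀ i, g.coeff i ∈ IsLocalRing.maximalIdeal R := by
  rw [reesMax_eq_map, ← Ideal.mem_map_C_iff]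
  have h := Ideal.comap_map_of_bijective (polynomialToRees a) (polynomialToRees_bijective ha)
    (I := (IsLocalRing.maximalIdeal R).map (C : R →+* R[X]))
  rw [← Ideal.mem_comap, h]

theorem coeff_mem_of_mem_reesExtension {I Q J : Ideal R} (hQJ : Q ≤ J) {f : R[X]}
    (hf : f ∈ reesExtension I Q J) (i : ℕ) : f.coeff i ∈ J ^ i * I := by
  induction hf using Submodule.span_induction generalizing i with
  | mem f hf =>
    obtain ⟨x, hx, g, hg, rfl⟩ := hf
    rw [coeff_C_mul, mul_comm x]
    exact Ideal.mul_mem_mul ((mem_reesAlgebra_iff _ _).1 hg i) hx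
  | zero => simp
  | add f g _ _ hf hg =>
    rw [coeff_add]
    exact Ideal.add_mem _ (hf i) (hg i)
  | smul t f _ hf =>
    change (t.1 * f).coeff i ∈ _
    rw [coeff_mul]
    refine Ideal.sum_mem _ fun jk hjk => ?_
    obtain rfl := Finset.HasAntidiagonal.mem_antidiagonal.1 hjk
    rw [pow_add, mul_assoc]
    exact Ideal.mul_mem_mul (Ideal.pow_right_mono hQJ _ ((mem_reesAlgebra_iff _ _).1 t.2 _)) (hf _)

theorem monomial_mem_reesExtension {I Q J : Ideal R} {i : ℕ} {w : R} (hw : w ∈ J ^ i * I) :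
    monomial i w ∈ reesExtension I Q J := by
  induction hw using Submodule.mul_induction_on' with
  | mem_mul_mem m hm x hx =>
    refine Submodule.subset_span ⟨x, hx, monomial i m, ?_, ?_⟩
    · exact reesAlgebra.monomial_mem.2 hm
    · rw [C_mul_monomial, mul_comm]
  | add x _ y _ hx hy =>
    rw [map_add]
    exact Submodule.add_mem _ hx hy

theorem mem_reesExtension_iff {I Q J : Ideal R} (hQJ : Q ≤ J) {f : R[X]} :
    f ∈ reesExtension I Q J ↔ ∀ i, f.coeff i ∈ J ^ i * I := by
  refine ⟨coeff_mem_of_mem_reesExtension hQJ, fun h => ?_⟩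
  rw [f.as_sum_support]
  exact Submodule.sum_mem _ fun i _ => monomial_mem_reesExtension (h i)

end ReesAlgebra

/-! ### Dividing degree i by aⁱ⁺¹ -/

section Rescaling

variable {R Q : Type u} [CommRing R] [CommRing Q] [Algebra R Q]

/-- The map `∑ fᵢ tⁱ ↦ ∑ (fᵢ / a ^ (i + 1)) Xⁱ`. -/
noncomputable def rescale (ζ : Qˣ) : R[X] →+ Q[X] :=
  (AddMonoidHom.mulLeft (C (↑ζ⁻¹ : Q))).comp
    ((Polynomial.compRingHom (C (↑ζ⁻¹ : Q) * X)).toAddMonoidHom.comp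
      (Polynomial.mapRingHom (algebraMap R Q)).toAddMonoidHom)

theorem rescale_apply (ζ : Qˣ) (f : R[X]) :
    rescale ζ f = C (↑ζ⁻¹ : Q) * (f.map (algebraMap R Q)).comp (C (↑ζ⁻¹ : Q) * X) := rfl

theorem coeff_rescale (ζ : Qˣ) (f : R[X]) (i : ℕ) :
    (rescale ζ f).coeff i = ↑(ζ ^ (i + 1))⁻¹ * algebraMap R Q (f.coeff i) := by
  rw [rescale_apply, coeff_C_mul, comp_C_mul_X_coeff, coeff_map, pow_succ, mul_inv_rev, ← inv_pow,
    Units.val_mul, Units.val_pow_eq_pow_val]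
  ring

theorem rescale_smul {ζ : Qˣ} {a : R} (hζ : (ζ : Q) = algebraMap R Q a) (g f : R[X]) :
    rescale ζ (polynomialToRees a g • f) = g.map (algebraMap R Q) * rescale ζ f := by
  rw [polynomialToRees_smul, rescale_apply, rescale_apply, Polynomial.map_mul, mul_comp,
    Polynomial.map_comp, comp_assoc]
  have h : ((C a * X : R[X]).map (algebraMap R Q)).comp (C (↑ζ⁻¹ : Q) * X) = X := by
    rw [Polynomial.map_mul, map_C, map_X, mul_comp, C_comp, X_comp, ← hζ, ← mul_assoc, ← C_mul,
      Units.mul_inv, C_1, one_mul]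
  rw [h, comp_X]
  ring

theorem exists_polynomial_coeff_sub_mem {X : Submodule R Q} {y : Q} {F : Q[X]}
    (hF : ∀ i, F.coeff i ∈ X ⊔ Submodule.span R {y}) :
    ∃ h : R[X], ∀ i, (F - h.map (algebraMap R Q) * C y).coeff i ∈ X := by
  have h1 : ∀ i, ∃ c : R, F.coeff i - c • y ∈ X := by
    intro i
    obtain ⟨x, hx, v, hv, hxv⟩ := Submodule.mem_sup.1 (hF i)
    obtain ⟨c, rfl⟩ := Submodule.mem_span_singleton.1 hv
    exact ⟨c, by rw [← hxv, add_sub_cancel_right]; exact hx⟩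
  choose c hc using h1
  refine ⟨∑ i ∈ F.support, monomial i (c i), fun i => ?_⟩
  rw [coeff_sub, coeff_mul_C, coeff_map, finsetSum_coeff]
  simp only [coeff_monomial, Finset.sum_ite_eq', mem_support_iff]
  split_ifs with h
  · rw [← Algebra.smul_def]
    exact hc i
  · rw [notMem_support_iff.1 h]
    simp

end Rescaling

/-! ### The rank of the Sally module -/

section SallyRank

variable {R Q : Type u} [CommRing R] [CommRing Q] [Algebra R Q]

theorem forall_coeff_mul_X_pow_mem_iff {X : Submodule R Q} {F : Q[X]} {n : ℕ} :
    (∀ i, (F * Polynomial.X ^ n).coeff i ∈ X) ↔ ∀ i, F.coeff i ∈ X := by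
  constructor
  · intro h i
    simpa using h (i + n)
  · intro h i
    rw [coeff_mul_X_pow']
    split_ifs
    · exact h _
    · exact X.zero_mem

theorem mem_span_pow_mul_iff (hinj : Function.Injective (algebraMap R Q)) {I : Ideal R} {a : R}
    {ζ : Qˣ} (hζ : (ζ : Q) = algebraMap R Q a) (i : ℕ) {w : R} :
    w ∈ Ideal.span {a} ^ i * I ↔ ↑(ζ ^ (i + 1))⁻¹ * algebraMap R Q w ∈ fracIdeal Q I a := by
  have h1 : Submodule.map (Algebra.linearMap R Q) (Ideal.span {a} ^ i * I) =
      unitSpan R (ζ ^ (i + 1)) * fracIdeal Q I a := by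
    rw [Ideal.span_singleton_pow, map_span_singleton_mul (β := ζ ^ i) (by simp [hζ]),
      fracIdeal_eq hζ, ← mul_assoc, unitSpan_mul, pow_succ, mul_inv_cancel_right]
  rw [← mem_unitSpan_mul, ← h1]
  constructor
  · exact fun hw => ⟨w, hw, rfl⟩
  · rintro ⟨v, hv, h⟩
    rwa [← hinj h]

theorem exists_generators_of_relLength_eq_two [IsLocalRing R] {M : Type*} [AddCommGroup M]
    [Module R M] {X Y : Submodule R M} (hXY : X ≤ Y) (h : relLength X Y = 2) :
    ∃ y ∈ Y, ∃ z ∈ Y, y ∉ X ∧ (∀ r ∈ IsLocalRing.maximalIdeal R, r • y ∈ X) ∧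
      z ∉ X ⊔ Submodule.span R {y} ∧
      (∀ r ∈ IsLocalRing.maximalIdeal R, r • z ∈ X ⊔ Submodule.span R {y}) ∧
      Y ≤ X ⊔ Submodule.span R {y} ⊔ Submodule.span R {z} := by
  have htwo : (2 : ℕ∞) ≠ ⊤ := ENat.natCast_ne_top 2
  have hle : ¬ Y ≤ X := fun h' => by
    rw [relLength_eq_zero_iff.2 h'] at h
    norm_cast at h
  obtain ⟨y, hyY, hyX, hy⟩ := exists_smul_mem_of_relLength_ne_top (by rwa [h]) hle
  set X' := X ⊔ Submodule.span R {y}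
  have hX'Y : X' ≤ Y := sup_le hXY (by rwa [Submodule.span_singleton_le_iff_mem])
  have h1 : relLength X X' = 1 := relLength_eq_one_of_forall_smul_mem le_rfl hy fun h' =>
    hyX (h' (Submodule.mem_sup_right (Submodule.mem_span_singleton_self y)))
  have h2 : relLength X' Y = 1 := by
    rw [relLength_add le_sup_left hX'Y, h1] at h
    generalize relLength X' Y = q at *
    have hq : q ≠ ⊤ := by
      rintro rfl
      rw [add_top] at h
      exact htwo h.symm
    lift q to ℕ using hq
    norm_cast at *
    omega
  have hle' : ¬ Y ≤ X' := fun h' => by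
    rw [relLength_eq_zero_iff.2 h'] at h2
    norm_cast at h2
  obtain ⟨z, hzY, hzX, hz⟩ := exists_smul_mem_of_relLength_ne_top
    (by rw [h2]; exact ENat.natCast_ne_top 1) hle'
  refine ⟨y, hyY, z, hzY, hyX, hy, hzX, hz, ?_⟩
  have h3 : X' ⊔ Submodule.span R {z} ≤ Y :=
    sup_le hX'Y (by rwa [Submodule.span_singleton_le_iff_mem])
  have h4 : relLength X' (X' ⊔ Submodule.span R {z}) = 1 :=
    relLength_eq_one_of_forall_smul_mem le_rfl hz fun h' =>
      hzX (h' (Submodule.mem_sup_right (Submodule.mem_span_singleton_self z)))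
  exact (eq_of_relLength_add_le le_sup_left h3 (by rw [h4]; exact ENat.natCast_ne_top 1)
    (by rw [h2, h4])).ge

/-- If `ℓ (Kⁿ / K) = 2` and `Kⁿ⁺¹ = Kⁿ`, for `K = I / a`, then the Sally module of `I` with respect
to `(a)` has rank two. -/
theorem hasSallyRank_two [IsLocalRing R] (hinj : Function.Injective (algebraMap R Q))
    {I : Ideal R} {a : R} (ha : a ∈ I) {ζ : Qˣ} (hζ : (ζ : Q) = algebraMap R Q a) {n : ℕ}
    (hle : fracIdeal Q I a ≤ fracIdeal Q I a ^ n)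
    (hpow : fracIdeal Q I a ^ (n + 1) = fracIdeal Q I a ^ n)
    (hlen : relLength (fracIdeal Q I a) (fracIdeal Q I a ^ n) = 2) :
    HasSallyRank I (Ideal.span {a}) 2 := by
  have haz := mem_nonZeroDivisors_of_unit hinj hζ
  have hQI : Ideal.span {a} ≤ I := (Ideal.span_singleton_le_iff_mem I).2 ha
  refine ⟨reesMax_isPrime haz, ?_⟩
  have := reesMax_isPrime haz
  set K := fracIdeal Q I a with hK
  have h1K : 1 ≤ K := one_le_fracIdeal ha
  obtain ⟨y, hyS, z, hzS, hyK, hmy, hzX, hmz, hgen⟩ :=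
    exists_generators_of_relLength_eq_two hle hlen
  have hstab : ∀ k, K ^ k ≤ K ^ n := by
    intro k
    have h1 : K ^ (n + k) = K ^ n := by
      induction k with
      | zero => rfl
      | succ k ih => rw [← add_assoc, pow_succ, ih, ← pow_succ, hpow]
    rw [← h1, pow_add]
    simpa using mul_le_mul_left (one_le_pow₀ h1K : 1 ≤ K ^ n) (K ^ k)
  set E := reesExtension I (Ideal.span {a}) I with hE
  set E₀ := reesExtension I (Ideal.span {a}) (Ideal.span {a}) with hE₀
  have hmem₀ : ∀ f : R[X], f ∈ E₀ ↔ ∀ i, (rescale ζ f).coeff i ∈ K := by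
    intro f
    rw [hE₀, mem_reesExtension_iff le_rfl]
    simp only [coeff_rescale, mem_span_pow_mul_iff hinj hζ]
    rfl
  have hmem : ∀ f ∈ E, ∀ i, (rescale ζ f).coeff i ∈ K ^ n := by
    intro f hf i
    have h1 := (mem_reesExtension_iff hQI).1 hf i
    rw [← pow_succ] at h1
    refine hstab (i + 1) ?_
    rw [coeff_rescale, ← mem_unitSpan_mul, unitSpan_pow_mul_fracIdeal_pow hζ]
    exact ⟨_, h1, rfl⟩
  -- Only in degree n is all of Kⁿ reached: there Iⁿ⁺¹/aⁿ⁺¹ = Kⁿ⁺¹ = Kⁿ. Hence the generators y and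
  -- z of Kⁿ/K are lifted with a factor Xⁿ.
  have hlift : ∀ x ∈ K ^ n, ∃ f ∈ E, rescale ζ f = C x * X ^ n := by
    intro x hx
    have h1 : (ζ ^ (n + 1) : Qˣ) * x ∈ unitSpan R (ζ ^ (n + 1)) * K ^ (n + 1) := by
      rw [mem_unitSpan_mul, Units.inv_mul_cancel_left, hpow]
      exact hx
    rw [unitSpan_pow_mul_fracIdeal_pow hζ] at h1
    obtain ⟨w, hw, hwx⟩ := h1
    refine ⟨monomial n w, monomial_mem_reesExtension (by rw [← pow_succ]; exact hw), ?_⟩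
    ext i
    rw [coeff_rescale, coeff_C_mul_X_pow, coeff_monomial]
    split_ifs with h h' h'
    · subst h
      rw [Algebra.linearMap_apply] at hwx
      rw [hwx, Units.inv_mul_cancel_left]
    · exact absurd h.symm h'
    · exact absurd h'.symm h
    · rw [map_zero, mul_zero]
  obtain ⟨f, hfE, hf⟩ := hlift y hyS
  obtain ⟨g, hgE, hg⟩ := hlift z hzS
  let q : E → SallyModule I (Ideal.span {a}) := Submodule.Quotient.mk
  have hq : ∀ u v : E, q u = q v ↔ ∀ i, (rescale ζ (u : R[X]) - rescale ζ (v : R[X])).coeff i ∈ K := by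
    intro u v
    rw [← map_sub, ← hmem₀]
    exact Submodule.Quotient.eq _
  have hq0 : ∀ u : E, q u = 0 ↔ ∀ i, (rescale ζ (u : R[X])).coeff i ∈ K := by
    intro u
    rw [← hmem₀]
    exact Submodule.Quotient.mk_eq_zero _
  set ρ := polynomialToRees a with hρ
  have hρs : Function.Surjective ρ := (polynomialToRees_bijective haz).2
  have hρmem : ∀ h : R[X], ρ h ∈ reesMax (Ideal.span {a}) ↔
      ∀ i, h.coeff i ∈ IsLocalRing.maximalIdeal R := fun h => polynomialToRees_mem_reesMax haz
  have hsmul : ∀ (h : R[X]) (u : E), rescale ζ ((ρ h • u : E) : R[X]) =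
      h.map (algebraMap R Q) * rescale ζ (u : R[X]) := fun h u => rescale_smul hζ h u
  set ξ : E := ⟨f, hfE⟩ with hξ
  set η : E := ⟨g, hgE⟩ with hη
  have hcoeff : ∀ (h : R[X]) (x : Q) (i : ℕ),
      (h.map (algebraMap R Q) * C x).coeff i = h.coeff i • x := by
    intro h x i
    rw [coeff_mul_C, coeff_map, Algebra.smul_def]
  have hξ0 : ∀ h : R[X], ρ h • q ξ = 0 ↔ ∀ i, h.coeff i • y ∈ K := by
    intro h
    refine (hq0 (ρ h • ξ)).trans ?_
    rw [hsmul, hf, ← mul_assoc, forall_coeff_mul_X_pow_mem_iff]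
    simp only [hcoeff]
  have hspan : ∀ (h : R[X]), ρ h • q η ∈ Submodule.span (Rees (Ideal.span {a})) {q ξ} ↔
      ∀ i, h.coeff i • z ∈ K ⊔ Submodule.span R {y} := by
    intro h
    rw [Submodule.mem_span_singleton]
    have h1 : ∀ k : R[X], ρ k • q ξ = ρ h • q η ↔
        ∀ i, (h.map (algebraMap R Q) * C z - k.map (algebraMap R Q) * C y).coeff i ∈ K := by
      intro k
      refine (eq_comm.trans (hq (ρ h • η) (ρ k • ξ))).trans ?_
      rw [hsmul, hsmul, hf, hg, ← mul_assoc, ← mul_assoc, ← sub_mul,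
        forall_coeff_mul_X_pow_mem_iff]
    constructor
    · rintro ⟨t, ht⟩ i
      obtain ⟨k, rfl⟩ := hρs t
      have h2 := (h1 k).1 ht i
      rw [coeff_sub, hcoeff, hcoeff] at h2
      rw [← sub_add_cancel (h.coeff i • z) (k.coeff i • y)]
      exact Submodule.add_mem_sup h2
        (Submodule.smul_mem _ _ (Submodule.mem_span_singleton_self y))
    · intro h2
      obtain ⟨k, hk⟩ := exists_polynomial_coeff_sub_mem
        (F := h.map (algebraMap R Q) * C z) (X := K) (y := y) (by
          intro i
          rw [hcoeff]
          exact h2 i)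
      exact ⟨ρ k, (h1 k).2 hk⟩
  -- If x is not in X, a scalar carrying x into X is not a unit.
  have hunit : ∀ {X : Submodule R Q} {x : Q} {h : R[X]}, x ∉ X →
      (∀ i, h.coeff i • x ∈ X) → ρ h ∈ reesMax (Ideal.span {a}) := by
    intro X x h hx hX
    rw [hρmem]
    intro i
    rw [IsLocalRing.mem_maximalIdeal, mem_nonunits_iff]
    intro hu
    obtain ⟨s, hs⟩ := hu.exists_left_inv
    refine hx ?_
    rw [← one_smul R x, ← hs, mul_smul]
    exact X.smul_mem s (hX i)
  refine length_localizedModule_eq_two (ξ := q ξ) (η := q η) ?_ ?_ ?_ ?_ ?_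
  · intro r hr
    obtain ⟨h, rfl⟩ := hρs r
    exact (hξ0 h).2 fun i => hmy _ ((hρmem h).1 hr i)
  · intro r hr
    obtain ⟨h, rfl⟩ := hρs r
    exact (hspan h).2 fun i => hmz _ ((hρmem h).1 hr i)
  · refine ⟨ρ (X ^ n), ?_, ?_⟩
    · rw [hρmem]
      intro h
      have := h n
      rw [coeff_X_pow, if_pos rfl] at this
      exact (Ideal.ne_top_iff_one _).1 (IsLocalRing.maximalIdeal.isMaximal R).ne_top this
    · intro v
      obtain ⟨⟨v, hv⟩, rfl⟩ := Submodule.Quotient.mk_surjective _ v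
      obtain ⟨k, hk⟩ := exists_polynomial_coeff_sub_mem (F := rescale ζ v)
        (X := K ⊔ Submodule.span R {y}) (y := z) (fun i => hgen (hmem v hv i))
      obtain ⟨l, hl⟩ := exists_polynomial_coeff_sub_mem hk
      have h1 : ρ (X ^ n) • q ⟨v, hv⟩ = ρ l • q ξ + ρ k • q η := by
        refine (hq (ρ (X ^ n) • ⟨v, hv⟩) (ρ l • ξ + ρ k • η)).2 ?_
        rw [Submodule.coe_add, map_add, hsmul, hsmul, hsmul, hf, hg]
        have h2 : (X ^ n : R[X]).map (algebraMap R Q) * rescale ζ v -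
            (l.map (algebraMap R Q) * (C y * X ^ n) + k.map (algebraMap R Q) * (C z * X ^ n)) =
            (rescale ζ v - k.map (algebraMap R Q) * C z - l.map (algebraMap R Q) * C y) *
              X ^ n := by
          rw [Polynomial.map_pow, map_X]
          ring
        rw [h2, forall_coeff_mul_X_pow_mem_iff]
        exact hl
      have h3 := Submodule.add_mem_sup
        (Submodule.smul_mem _ (ρ l) (Submodule.mem_span_singleton_self (q ξ)))
        (Submodule.smul_mem _ (ρ k) (Submodule.mem_span_singleton_self (q η)))
      rw [← h1] at h3
      exact h3
  · intro t ht h0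
    obtain ⟨h, rfl⟩ := hρs t
    exact ht (hunit hyK ((hξ0 h).1 h0))
  · intro t ht h0
    obtain ⟨h, rfl⟩ := hρs t
    exact ht (hunit hzX ((hspan h).1 h0))

end SallyRank

end TwoAGL

theorem theorem6p9 {R Q : Type u} [CommRing R] [IsLocalRing R]
    [CommRing Q] [Algebra R Q] [IsFractionRing R Q]
    -- `R` is a one-dimensional Cohen-Macaulay local ring, `I` a canonical ideal of `R`, and
    -- `(a)` a parameter ideal that is a reduction of `I`
    (hCM : TwoAGL.IsCohenMacaulayLocal R) (hdim : ringKrullDim R = 1)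
    (I : Ideal R) (hI : I ≠ ⊤) (hIcan : TwoAGL.IsCanonicalModule R I)
    (a : R) (ha : (Ideal.span {a}).radical = IsLocalRing.maximalIdeal R)
    (hred : TwoAGL.IsReduction (Ideal.span {a}) I)
    -- condition (1)
    (e : ℕ) (he : 3 ≤ e) (heR : TwoAGL.HasMultiplicity R e) (hR : ¬ TwoAGL.IsAGL R)
    -- condition (2)
    [IsLocalRing (TwoAGL.maxColonMax R Q)]
    (hB : TwoAGL.IsAGL (TwoAGL.maxColonMax R Q))
    (heB : TwoAGL.HasMultiplicity (TwoAGL.maxColonMax R Q) e)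
    -- condition (3)
    (α : R) (hα : α ∈ IsLocalRing.maximalIdeal R)
    (hm : IsLocalRing.maximalIdeal R ^ 2 = Ideal.span {α} * IsLocalRing.maximalIdeal R)
    (hn : IsLocalRing.maximalIdeal (TwoAGL.maxColonMax R Q) ^ 2 =
      Ideal.span {algebraMap R (TwoAGL.maxColonMax R Q) α} *
        IsLocalRing.maximalIdeal (TwoAGL.maxColonMax R Q)) :
    -- `R` is a 2-AGL ring
    TwoAGL.IsTwoAGL I (Ideal.span {a}) ∧
    -- `K / R` is a free `R / 𝔠`-module, with `K = I / a` and `𝔠 = R : R[K]`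
    ∃ r : ℕ, Nonempty
      ((TwoAGL.fracIdeal Q I a ⧸
          (1 : Submodule R Q).submoduleOf (TwoAGL.fracIdeal Q I a)) ≃ₗ[R]
        (Fin r → R ⧸ TwoAGL.conductor Q
          (Algebra.adjoin R (TwoAGL.fracIdeal Q I a : Set Q)))) := by
  have := hCM.noetherian
  have hinj : Function.Injective (algebraMap R Q) := IsFractionRing.injective R Q
  have haI : a ∈ I := hred.1 (Ideal.mem_span_singleton_self a)
  obtain ⟨ζ, hζ⟩ : IsUnit (algebraMap R Q a) :=
    IsLocalization.map_units Q ⟨a, (TwoAGL.exists_nonZeroDivisor_pow_le hCM hdim ha).1⟩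
  obtain ⟨n, r, hle, hpow, hlen, hc, h1, h2, hfg⟩ := TwoAGL.exists_overring_structure (Q := Q)
    hCM hdim I hIcan a ha hred e he heR hR hB heB α hα hm hn
  refine ⟨TwoAGL.hasSallyRank_two hinj haI hζ hle hpow hlen, r, ?_⟩
  rw [TwoAGL.maxSubmodule_mul_eq_smul] at h2
  refine TwoAGL.nonempty_equiv_of_relLength (TwoAGL.one_le_fracIdeal haI) hfg hc ?_ h1 h2
  -- The conductor carries all of R[K], in particular K, into R.
  intro s hs y hy
  rw [Algebra.smul_def]
  exact Submodule.mem_div_iff_forall_mul_mem.1 (TwoAGL.mem_conductor_iff.1 hs) y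
    (Algebra.subset_adjoin hy)
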